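/- Let $\mathcal W_2(\mathbb R)$ be the set of probability measures on $\mathbb R$ with finite second moment, with the quadratic Wasserstein distance $W_2(\mu,\nu)=\bigl(\inf_{\pi\in\Pi(\mu,\nu)}\int|x-y|^2\,d\pi(x,y)\bigr)^{1/2}$, where $\Pi(\mu,\nu)$ is the set of couplings of $\mu$ and $\nu$. Let $\Theta\subset\mathbb R^p$ and $\theta_0\in\Theta$. Assume that derivatives of functions on $\Theta$ are uniquely determined at every point of $\Theta$ (for instance: $\Theta$ is open, or $\Theta$ is convex with non-empty interior), and that points of $\Theta$ near $\theta_0$ are joined to $\theta_0$ by short paths in $\Theta$: for every $\varepsilon>0$ there is $\delta>0$ such that every $\theta\in\Theta$ with $\|\theta-\theta_0\|<\delta$ is the endpoint $\gamma(1)$ of an $\varepsilon$-Lipschitz path $\gamma:[0,1]\to\Theta$ with $\gamma(0)=\theta_0$ (for instance: $\theta_0$ is interior to $\Theta$, or $\Theta$ is convex). For every $\theta\in\Theta$ let $F_\theta:[0,\infty)\to\mathbb R$ be such that $K_\theta(\mu,\nu)=F_\theta(W_2(\mu,\nu))$ is a covariance function (a symmetric positive semidefinite kernel) on $\mathcal W_2(\mathbb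 R)$. Assume the following. 1. For every $n$ and $1\le i\le n$, $\mu_i=\mu_i^{(n)}\in\mathcal W_2(\mathbb R)$ has support in $[i,i+L]$, with a fixed $L<\infty$. 2. $\sup_{\theta\in\Theta}|F_\theta(t)|\le \dfrac{A}{1+t^{1+\tau}}$ for all $t\ge 0$, with fixed $A<\infty$ and $\tau>1$. 3. $Y=(Y(\mu))_{\mu\in\mathcal W_2(\mathbb R)}$ is a centered Gaussian process with covariance function $K_{\theta_0}$, and for each $n$ one observes $y=(y_1,\dots,y_n)$ with $y_i=Y(\mu_i)$. 4. There is a fixed $c>0$ such that, for all $n$ and $\theta\in\Theta$, the smallest eigenvalue of $R_\theta=(K_\theta(\mu_i,\mu_j))_{1\le i,j\le n}$ is at least $c$. 5. For all $\alpha>0$, $\displaystyle\liminf_{n\to\infty}\ \inf_{\theta\in\Theta,\ \|\theta-\theta_0\|\ge\alpha}\ \frac1n\sum_{i,j=1}^n\bigl[K_\theta(\mu_i,\mu_j)-K_{\theta_0}(\mu_i,\mu_j)\bigr]^2>0$ (with $\inf\emptyset=+\infty$). 6. For all $t\ge0$, $\theta\mapsto F_\theta(t)$ is continuously differentiable on $\Theta$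 and $\displaystyle\sup_{\theta\in\Theta}\max_{1\le i\le p}\Bigl|\frac{\partial}{\partial\theta_i}F_\theta(t)\Bigr|\le\frac{A}{1+t^{1+\tau}}$. 7. For all $t\ge0$, $\theta\mapsto F_\theta(t)$ is three times continuously differentiable on $\Theta$ and, for $q\in\{2,3\}$ and $i_1,\dots,i_q\in\{1,\dots,p\}$, $\displaystyle\sup_{\theta\in\Theta}\Bigl|\frac{\partial}{\partial\theta_{i_1}}\cdots\frac{\partial}{\partial\theta_{i_q}}F_\theta(t)\Bigr|\le\frac{A}{1+t^{1+\tau}}$. 8. For all $(\lambda_1,\dots,\lambda_p)\ne(0,\dots,0)$, $\displaystyle\liminf_{n\to\infty}\frac1n\sum_{i,j=1}^n\Bigl(\sum_{k=1}^p\lambda_k\frac{\partial}{\partial\theta_k}K_{\theta_0}(\mu_i,\mu_j)\Bigr)^2>0$. For each $n$ let $\hat\theta_{ML}$ be a maximum likelihood estimator, that is, almost surely $\hat\theta_{ML}\in\operatorname{argmin}_{\theta\in\Theta}L_\theta$ with $L_\theta=\frac1n\ln\det R_\theta+\frac1n\,y^tR_\theta^{-1}y$. For $\mu\in\mathcal W_2(\mathbb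 R)$ let $\hat Y_\theta(\mu)=r_\theta(\mu)^tR_\theta^{-1}y$ with $r_\theta(\mu)=(K_\theta(\mu,\mu_i))_{1\le i\le n}$, and let $\hat Y_{ML}(\mu)=\hat Y_{\hat\theta_{ML}}(\mu)$. Then $$\forall\mu\in\mathcal W_2(\mathbb R),\qquad\bigl|\hat Y_{ML}(\mu)-\hat Y_{\theta_0}(\mu)\bigr|=o_{\mathbb P}(1)\quad\text{as }n\to\infty.$$ -/

import Mathlib

open MeasureTheory ProbabilityTheory Filter Topology

noncomputable section

namespace Kriging

/-- The set `𝒲₂(ℝ)` of probability measures on `ℝ` with a finite moment of order two. -/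
structure W2Space where
  measure : Measure ℝ
  isProb : IsProbabilityMeasure measure
  secondMoment : Integrable (fun x : ℝ => x ^ 2) measure

/-- The couplings of `μ` and `ν`: measures on `ℝ × ℝ` with first marginal `μ` and second
marginal `ν` (such a measure is automatically a probability measure). -/
def couplings (μ ν : W2Space) : Set (Measure (ℝ × ℝ)) :=
  {π | π.map Prod.fst = μ.measure ∧ π.map Prod.snd = ν.measure}

/-- The quadratic transportation cost.  The set of couplings is never empty (it contains the
product measure), and every coupling of two measures with finite second moments has a finite
quadratic cost, so this is a genuine infimum of nonnegative reals. -/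
def transportCost (μ ν : W2Space) : ℝ :=
  ⨅ π : couplings μ ν, ∫ z : ℝ × ℝ, |z.1 - z.2| ^ 2 ∂(π : Measure (ℝ × ℝ))

/-- The quadratic Wasserstein distance. -/
def W2 (μ ν : W2Space) : ℝ := Real.sqrt (transportCost μ ν)

/-- `K` is a covariance function on `E`: every matrix `(K (x i) (x j))` is symmetric and
`∑ λ i * λ j * K (x i) (x j) ≥ 0`. -/
def IsCovarianceFunction {E : Type*} (K : E → E → ℝ) : Prop :=
  ∀ (m : ℕ) (x : Fin m → E), (Matrix.of fun i j => K (x i) (x j)).PosSemidef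

variable {p : ℕ}

/-- The covariance function `K_θ(μ, ν) = F_θ(W₂(μ, ν))`.  Only the values of `F θ` on `[0, ∞)`
matter. -/
def cov (F : EuclideanSpace ℝ (Fin p) → ℝ → ℝ) (θ : EuclideanSpace ℝ (Fin p))
    (μ ν : W2Space) : ℝ :=
  F θ (W2 μ ν)

/-- The covariance matrix `R_θ = (K_θ(x i, x j))`. -/
def covMatrix (F : EuclideanSpace ℝ (Fin p) → ℝ → ℝ) {n : ℕ} (x : Fin n → W2Space)
    (θ : EuclideanSpace ℝ (Fin p)) : Matrix (Fin n) (Fin n) ℝ :=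
  Matrix.of fun i j => cov F θ (x i) (x j)

/-- The vector `r_θ(μ) = (K_θ(μ, x i))`. -/
def covVector (F : EuclideanSpace ℝ (Fin p) → ℝ → ℝ) {n : ℕ} (x : Fin n → W2Space)
    (μ : W2Space) (θ : EuclideanSpace ℝ (Fin p)) : Fin n → ℝ :=
  fun i => cov F θ μ (x i)

/-- The normalized Gaussian criterion `L_θ = (1/n) log det R_θ + (1/n) yᵗ R_θ⁻¹ y`, which the
maximum likelihood estimator minimizes. -/
def mlCriterion (F : EuclideanSpace ℝ (Fin p) → ℝ → ℝ) {n : ℕ} (x : Fin n → W2Space)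
    (y : Fin n → ℝ) (θ : EuclideanSpace ℝ (Fin p)) : ℝ :=
  1 / (n : ℝ) * Real.log (covMatrix F x θ).det
    + 1 / (n : ℝ) * (y ⬝ᵥ Matrix.mulVec (covMatrix F x θ)⁻¹ y)

/-- The Kriging predictor `Ŷ_θ(μ) = r_θ(μ)ᵗ R_θ⁻¹ y`. -/
def predictor (F : EuclideanSpace ℝ (Fin p) → ℝ → ℝ) {n : ℕ} (x : Fin n → W2Space)
    (y : Fin n → ℝ) (μ : W2Space) (θ : EuclideanSpace ℝ (Fin p)) : ℝ :=
  covVector F x μ θ ⬝ᵥ Matrix.mulVec (covMatrix F x θ)⁻¹ y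

/-- The partial derivative of order `q`, `∂/∂θ_{i 0} ⋯ ∂/∂θ_{i (q-1)} g (θ)`, of a function `g`
on the set `Θ`.  On an open `Θ` this is the usual partial derivative. -/
def partialDeriv {q : ℕ} (Θ : Set (EuclideanSpace ℝ (Fin p))) (i : Fin q → Fin p)
    (g : EuclideanSpace ℝ (Fin p) → ℝ) (θ : EuclideanSpace ℝ (Fin p)) : ℝ :=
  iteratedFDerivWithin ℝ q g Θ θ (fun k => EuclideanSpace.single (i k) (1 : ℝ))

/-- The length distance of `Θ` is continuous at `θ₀`: points of `Θ` close to `θ₀` are joined to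
`θ₀` by short paths inside `Θ`.  This holds for instance if `θ₀` is an interior point of `Θ`, or
if `Θ` is convex. -/
def ShortPathsAt (Θ : Set (EuclideanSpace ℝ (Fin p))) (θ₀ : EuclideanSpace ℝ (Fin p)) : Prop :=
  ∀ ε : NNReal, 0 < ε → ∃ δ : ℝ, 0 < δ ∧ ∀ θ ∈ Θ, ‖θ - θ₀‖ < δ →
    ∃ γ : ℝ → EuclideanSpace ℝ (Fin p), γ 0 = θ₀ ∧ γ 1 = θ ∧
      Set.MapsTo γ (Set.Icc 0 1) Θ ∧ LipschitzOnWith ε γ (Set.Icc 0 1)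

end Kriging

end

noncomputable section

namespace Kriging

open scoped Matrix

/-! The predictor is continuous in the covariance model, uniformly in `n`, and the estimator is
consistent; together these give the result, and no rate of convergence is needed.

Stability. The supports drift to infinity, so `R_θ` decays polynomially off the diagonal, with
index-weighted row sums bounded uniformly in `n` and `θ`. Multiplication by the weight `1 + i`
therefore almost commutes with `R_θ`, and coercivity bounds `R_θ⁻¹ r_θ(μ)` and its variation in `θ`
in a weighted norm (`l2_weight_inv_mulVec_sub_le`). The dual weighted norm of the observations is
bounded in probability because `∑ (1 + i)⁻²` converges (`measureReal_l2_div_ge_le`). Hence the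
predictors at `θ` and `θ₀` are close once `θ` is close to `θ₀` along a short path.

Consistency. The mean of the likelihood excess is a Gaussian Kullback-Leibler divergence, which
dominates the squared Frobenius distance (`klConst_mul_le`); away from `θ₀` the latter is of order
`n`. It remains to show that the random fluctuations are `o(n)` uniformly in `θ`
(`tendsto_measureReal_exists_fluct`). For a single `θ` this is Chebyshev's inequality.

Uniformity over a possibly unbounded `Θ` is the delicate point. It comes from the geometry of the
Wasserstein space: Euclidean boxes of every dimension embed in it up to scaling, so a bounded
covariance `F(W₂)` is positive semidefinite in all dimensions, and this forces `F` to be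
nonincreasing (`antitoneOn_of_isCovarianceFunction`). Bounded monotone functions are totally bounded
in mean, so the matrices `R_θ` have finite nets for the normalized entrywise `ℓ¹` distance, of
cardinality independent of `n` (`exists_finite_net`). This weak distance controls the quadratic
forms because the inverses act boundedly on `ℓ⁴` and `∑ y_i⁴ = O(n)` in probability
(`abs_quadForm_inv_sub_le`). -/

/-- The Euclidean norm of a finite real vector. -/
def l2 {ι : Type*} [Fintype ι] (v : ι → ℝ) : ℝ := ‖(WithLp.toLp 2 v : EuclideanSpace ℝ ι)‖

/-! ### Euclidean norms and Schur tests in `ℓ²` and `ℓ⁴`. -/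

section L2

variable {ι κ : Type*} [Fintype ι] [Fintype κ]

lemma l2_nonneg (v : ι → ℝ) : 0 ≤ l2 v := norm_nonneg _

lemma l2_sq (v : ι → ℝ) : l2 v ^ 2 = ∑ i, v i ^ 2 := by
  simp [l2, EuclideanSpace.real_norm_sq_eq]

lemma l2_sq_eq_dotProduct (v : ι → ℝ) : l2 v ^ 2 = v ⬝ᵥ v := by
  rw [l2_sq]; simp [dotProduct, sq]

lemma l2_add_le (v w : ι → ℝ) : l2 (v + w) ≤ l2 v + l2 w := by
  simpa [l2] using norm_add_le (WithLp.toLp 2 v : EuclideanSpace ℝ ι) (WithLp.toLp 2 w)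

lemma l2_sub_le (v w : ι → ℝ) : l2 (v - w) ≤ l2 v + l2 w := by
  simpa [l2] using norm_sub_le (WithLp.toLp 2 v : EuclideanSpace ℝ ι) (WithLp.toLp 2 w)

lemma l2_le_of_sq_le {v : ι → ℝ} {a : ℝ} (ha : 0 ≤ a) (h : ∑ i, v i ^ 2 ≤ a ^ 2) : l2 v ≤ a :=
  le_of_sq_le_sq (by rwa [l2_sq]) ha

lemma abs_dotProduct_le (v w : ι → ℝ) : |v ⬝ᵥ w| ≤ l2 v * l2 w := by
  have := abs_real_inner_le_norm (WithLp.toLp 2 w : EuclideanSpace ℝ ι) (WithLp.toLp 2 v)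
  rw [EuclideanSpace.inner_toLp_toLp] at this
  simpa [l2, mul_comm] using this

lemma sum_abs_mul_abs_le (v w : ι → ℝ) : ∑ i, |v i| * |w i| ≤ l2 v * l2 w := by
  have h := abs_dotProduct_le (fun i => |v i|) (fun i => |w i|)
  have e : ∀ u : ι → ℝ, l2 (fun i => |u i|) = l2 u := fun u => by
    rw [← sq_eq_sq₀ (l2_nonneg _) (l2_nonneg _), l2_sq, l2_sq]; simp
  rw [e, e] at h
  exact (le_abs_self _).trans h

lemma l2_mono {v w : ι → ℝ} (h : ∀ i, |v i| ≤ |w i|) : l2 v ≤ l2 w := by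
  refine l2_le_of_sq_le (l2_nonneg _) ?_
  rw [l2_sq]
  exact Finset.sum_le_sum fun i _ => sq_le_sq.2 (h i)

lemma l2_le_sum_abs (v : ι → ℝ) : l2 v ≤ ∑ i, |v i| := by
  refine l2_le_of_sq_le (Finset.sum_nonneg fun i _ => abs_nonneg _) ?_
  have := Finset.sum_sq_le_sq_sum_of_nonneg (s := Finset.univ) (f := fun i => |v i|)
    (fun i _ => abs_nonneg _)
  simpa using this

/-- Cauchy-Schwarz for the weights `|M i j|`; iterating it gives the Schur tests for both exponents.
-/
lemma sq_mulVec_apply_le {ι' : Type*} {M : Matrix ι' κ ℝ} {S : ℝ} (i : ι') (hrow : ∑ j, |M i j| ≤ S)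
    (v : κ → ℝ) : (M.mulVec v i) ^ 2 ≤ S * ∑ j, |M i j| * v j ^ 2 := by
  have h1 : (∑ j, M i j * v j) ^ 2 ≤ (∑ j, |M i j|) * ∑ j, |M i j| * v j ^ 2 := by
    refine (Finset.sum_sq_le_sum_mul_sum_of_sq_le_mul _ (fun j _ => abs_nonneg _)
      (fun j _ => by positivity) fun j _ => ?_)
    rw [← mul_assoc, mul_pow, ← sq_abs (M i j), sq (|M i j|)]
  exact h1.trans (mul_le_mul_of_nonneg_right hrow (Finset.sum_nonneg fun j _ => by positivity))

lemma sum_sum_mul_le {M : Matrix ι κ ℝ} {S : ℝ} (hcol : ∀ j, ∑ i, |M i j| ≤ S)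
    {a : κ → ℝ} (ha : ∀ j, 0 ≤ a j) : ∑ i, ∑ j, |M i j| * a j ≤ S * ∑ j, a j := by
  rw [Finset.sum_comm, Finset.mul_sum]
  refine Finset.sum_le_sum fun j _ => ?_
  rw [← Finset.sum_mul]
  exact mul_le_mul_of_nonneg_right (hcol j) (ha j)

lemma l2_mulVec_le {M : Matrix ι κ ℝ} {S : ℝ} (hS : 0 ≤ S) (hrow : ∀ i, ∑ j, |M i j| ≤ S)
    (hcol : ∀ j, ∑ i, |M i j| ≤ S) (v : κ → ℝ) : l2 (M.mulVec v) ≤ S * l2 v := by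
  refine l2_le_of_sq_le (mul_nonneg hS (l2_nonneg _)) ?_
  calc ∑ i, (M.mulVec v i) ^ 2 ≤ ∑ i, S * ∑ j, |M i j| * v j ^ 2 :=
        Finset.sum_le_sum fun i _ => sq_mulVec_apply_le i (hrow i) v
    _ = S * ∑ i, ∑ j, |M i j| * v j ^ 2 := by rw [Finset.mul_sum]
    _ ≤ S * (S * ∑ j, v j ^ 2) :=
        mul_le_mul_of_nonneg_left (sum_sum_mul_le hcol fun j => sq_nonneg _) hS
    _ = (S * l2 v) ^ 2 := by rw [mul_pow, l2_sq]; ring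

/-- Schur test in `ℓ⁴`. It carries fourth-moment control of the observations over to `R⁻¹ y`. -/
lemma sum_pow_four_mulVec_le {M : Matrix ι κ ℝ} {S : ℝ} (hS : 0 ≤ S)
    (hrow : ∀ i, ∑ j, |M i j| ≤ S) (hcol : ∀ j, ∑ i, |M i j| ≤ S) (v : κ → ℝ) :
    ∑ i, (M.mulVec v i) ^ 4 ≤ S ^ 4 * ∑ j, v j ^ 4 := by
  have key : ∀ i, (M.mulVec v i) ^ 4 ≤ S ^ 3 * ∑ j, |M i j| * v j ^ 4 := fun i => by
    have h1 := sq_mulVec_apply_le i (hrow i) v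
    have h2 : (∑ j, |M i j| * v j ^ 2) ^ 2 ≤ S * ∑ j, |M i j| * v j ^ 4 := by
      have h3 : (∑ j, |M i j| * v j ^ 2) ^ 2 ≤ (∑ j, |M i j|) * ∑ j, |M i j| * v j ^ 4 :=
        Finset.sum_sq_le_sum_mul_sum_of_sq_le_mul _ (fun j _ => abs_nonneg _)
          (fun j _ => by positivity) fun j _ => le_of_eq (by ring)
      exact h3.trans (mul_le_mul_of_nonneg_right (hrow i)
        (Finset.sum_nonneg fun j _ => by positivity))
    calc (M.mulVec v i) ^ 4 = ((M.mulVec v i) ^ 2) ^ 2 := by ring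
      _ ≤ (S * ∑ j, |M i j| * v j ^ 2) ^ 2 := pow_le_pow_left₀ (sq_nonneg _) h1 2
      _ = S ^ 2 * (∑ j, |M i j| * v j ^ 2) ^ 2 := by ring
      _ ≤ S ^ 2 * (S * ∑ j, |M i j| * v j ^ 4) := mul_le_mul_of_nonneg_left h2 (sq_nonneg _)
      _ = _ := by ring
  calc ∑ i, (M.mulVec v i) ^ 4 ≤ ∑ i, S ^ 3 * ∑ j, |M i j| * v j ^ 4 :=
        Finset.sum_le_sum fun i _ => key i
    _ = S ^ 3 * ∑ i, ∑ j, |M i j| * v j ^ 4 := by rw [Finset.mul_sum]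
    _ ≤ S ^ 3 * (S * ∑ j, v j ^ 4) :=
        mul_le_mul_of_nonneg_left (sum_sum_mul_le hcol fun j => by positivity) (by positivity)
    _ = _ := by ring

end L2

/-! ### Coercive matrices with weighted row bounds, and their inverses. -/

lemma sum_fin_dist_le {g : ℕ → ℝ} (hg : ∀ k, 0 ≤ g k) (hs : Summable g) {n : ℕ} (i : Fin n) :
    ∑ j : Fin n, g (Nat.dist i j) ≤ 2 * ∑' k, g k := by
  classical
  have aux : ∀ s : Finset (Fin n), Set.InjOn (fun j : Fin n => Nat.dist i j) s →
      ∑ j ∈ s, g (Nat.dist i j) ≤ ∑' k, g k := fun s h => by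
    rw [← Finset.sum_image (f := g) h]
    exact hs.sum_le_tsum _ fun k _ => hg k
  -- On each side of `i` the distance to `i` is injective, so every value occurs at most twice.
  rw [← Finset.sum_filter_add_sum_filter_not Finset.univ (fun j : Fin n => j ≤ i), two_mul]
  refine add_le_add (aux _ ?_) (aux _ ?_) <;>
  · intro a ha b hb hab
    simp only [Finset.coe_filter, Finset.mem_univ, true_and, Set.mem_ofPred_eq, not_le,
      Fin.le_def, Nat.dist] at ha hb hab
    ext; omega

lemma natDist_cast (i j : ℕ) : ((Nat.dist i j : ℕ) : ℝ) = |(i : ℝ) - j| := by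
  rcases le_total i j with h | h
  · rw [Nat.dist_eq_sub_of_le h, Nat.cast_sub h, abs_sub_comm, abs_of_nonneg]
    simpa using h
  · rw [Nat.dist_eq_sub_of_le_right h, Nat.cast_sub h, abs_of_nonneg]
    simpa using h

/-- Symmetric matrices with smallest eigenvalue at least `c` whose rows, weighted by the distance
to the diagonal, have absolute sum at most `S`. -/
structure WellConditioned (c S : ℝ) {n : ℕ} (R : Matrix (Fin n) (Fin n) ℝ) : Prop where
  symm : R.IsHermitian
  coercive : ∀ v : Fin n → ℝ, c * (v ⬝ᵥ v) ≤ v ⬝ᵥ R.mulVec v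
  rowSum : ∀ i, ∑ j, |R i j| * (1 + |(i : ℝ) - j|) ≤ S

lemma sum_abs_le_of_weighted {n : ℕ} {R : Matrix (Fin n) (Fin n) ℝ} {S : ℝ} (i : Fin n)
    (h : ∑ j, |R i j| * (1 + |(i : ℝ) - j|) ≤ S) : ∑ j, |R i j| ≤ S :=
  (Finset.sum_le_sum fun j _ => le_mul_of_one_le_right (abs_nonneg _)
    (by linarith [abs_nonneg ((i : ℝ) - j)])).trans h

lemma abs_symm {n : ℕ} {R : Matrix (Fin n) (Fin n) ℝ} (h : R.IsHermitian) (i j : Fin n) :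
    |R i j| = |R j i| := by
  have := h.apply i j
  simp at this
  rw [this]

/-- The commutator of a symmetric matrix with a weight that is Lipschitz in the index. -/
lemma l2_commutator_le {n : ℕ} {R : Matrix (Fin n) (Fin n) ℝ} {S : ℝ} (hS : 0 ≤ S)
    (hR : R.IsHermitian) (hrow : ∀ i, ∑ j, |R i j| * (1 + |(i : ℝ) - j|) ≤ S)
    {d : Fin n → ℝ} (hd : ∀ i j, |d i - d j| ≤ |(i : ℝ) - j|) (w : Fin n → ℝ) :
    l2 (R.mulVec (d * w) - d * R.mulVec w) ≤ S * l2 w := by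
  have hb : ∀ i j, |R i j * (d j - d i)| ≤ |R i j| * (1 + |(i : ℝ) - j|) := fun i j => by
    rw [abs_mul, abs_sub_comm]
    exact mul_le_mul_of_nonneg_left ((hd i j).trans (by linarith)) (abs_nonneg _)
  have e : R.mulVec (d * w) - d * R.mulVec w
      = (Matrix.of fun i j => R i j * (d j - d i)).mulVec w := by
    ext i
    simp only [Pi.sub_apply, Pi.mul_apply, Matrix.mulVec, dotProduct, Matrix.of_apply,
      Finset.mul_sum, ← Finset.sum_sub_distrib]
    exact Finset.sum_congr rfl fun j _ => by ring
  rw [e]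
  refine l2_mulVec_le hS (fun i => (Finset.sum_le_sum fun j _ => hb i j).trans (hrow i))
    (fun j => le_trans (Finset.sum_le_sum fun i _ => ?_) (hrow j)) w
  rw [abs_symm hR j i]
  have := hb i j
  rwa [abs_sub_comm (i : ℝ)] at this

namespace WellConditioned

variable {c S : ℝ} {n : ℕ} {R R' : Matrix (Fin n) (Fin n) ℝ}

lemma row (h : WellConditioned c S R) (i : Fin n) : ∑ j, |R i j| ≤ S :=
  sum_abs_le_of_weighted i (h.rowSum i)

lemma col (h : WellConditioned c S R) (j : Fin n) : ∑ i, |R i j| ≤ S := by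
  simpa only [abs_symm h.symm _ j] using h.row j

lemma posDef (hc : 0 < c) (h : WellConditioned c S R) : R.PosDef := by
  refine Matrix.PosDef.of_dotProduct_mulVec_pos h.symm fun x hx => ?_
  have h1 : 0 < x ⬝ᵥ x := by
    rw [← l2_sq_eq_dotProduct, l2_sq]
    obtain ⟨i, hi⟩ := Function.ne_iff.1 hx
    exact Finset.sum_pos' (fun i _ => sq_nonneg _) ⟨i, Finset.mem_univ _, by
      simpa using pow_pos (abs_pos.2 hi) 2⟩
  simpa using (mul_pos hc h1).trans_le (h.coercive x)

lemma mulVec_inv (hc : 0 < c) (h : WellConditioned c S R) (r : Fin n → ℝ) :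
    R.mulVec (R⁻¹.mulVec r) = r := by
  rw [Matrix.mulVec_mulVec, Matrix.mul_nonsing_inv _
    ((Matrix.isUnit_iff_isUnit_det _).1 (h.posDef hc).isUnit), Matrix.one_mulVec]

lemma l2_le_mulVec (h : WellConditioned c S R) (w : Fin n → ℝ) :
    c * l2 w ≤ l2 (R.mulVec w) := by
  rcases (l2_nonneg w).eq_or_lt with h0 | h0
  · rw [← h0, mul_zero]; exact l2_nonneg _
  · have h1 := (h.coercive w).trans ((le_abs_self _).trans (abs_dotProduct_le _ _))
    rw [← l2_sq_eq_dotProduct] at h1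
    exact le_of_mul_le_mul_left (by linarith [h1, sq (l2 w)]) h0

lemma l2_inv_mulVec_le (hc : 0 < c) (h : WellConditioned c S R) (r : Fin n → ℝ) :
    l2 (R⁻¹.mulVec r) ≤ l2 r / c := by
  have := h.l2_le_mulVec (R⁻¹.mulVec r)
  rw [h.mulVec_inv hc] at this
  rwa [le_div_iff₀' hc]

/-- Coercivity is applied to `d * w`; moving `d` past `R` costs only a bounded commutator, since `d`
is Lipschitz in the index. -/
lemma l2_weight_mul_le (hS : 0 ≤ S) (h : WellConditioned c S R) {d : Fin n → ℝ}
    (hd : ∀ i j, |d i - d j| ≤ |(i : ℝ) - j|) (w : Fin n → ℝ) :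
    c * l2 (d * w) ≤ l2 (d * R.mulVec w) + S * l2 w := by
  refine (h.l2_le_mulVec _).trans ?_
  have h1 := l2_add_le (R.mulVec (d * w) - d * R.mulVec w) (d * R.mulVec w)
  rw [sub_add_cancel] at h1
  linarith [l2_commutator_le hS h.symm h.rowSum hd w]

end WellConditioned

/-- A bound for the absolute row sums of the inverse of a `WellConditioned c S` matrix. -/
def invBound (c S : ℝ) : ℝ :=
  (1 + S / c) / c * Real.sqrt (2 * ∑' k : ℕ, (1 + (k : ℝ))⁻¹ ^ 2)

lemma summable_inv_sq : Summable fun k : ℕ => (1 + (k : ℝ))⁻¹ ^ 2 := by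
  have := (summable_nat_add_iff 1).2 (Real.summable_nat_pow_inv (p := 2) |>.2 (by norm_num))
  refine this.congr fun k => ?_
  push_cast; rw [add_comm, inv_pow]

namespace WellConditioned

variable {c S : ℝ} {n : ℕ} {R R' R₀ : Matrix (Fin n) (Fin n) ℝ}

lemma inv_symm (h : WellConditioned c S R) : R⁻¹.IsHermitian := h.symm.inv

/-- The column `w = R⁻¹ e_i` solves `R w = e_i`. With the weight `1 + |j - i|`, which equals `1` at
`i`, the commutator estimate bounds `w` in weighted `ℓ²`. Cauchy-Schwarz against the square-summable
inverse weight turns this into an `ℓ¹` bound. -/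
lemma inv_row (hc : 0 < c) (hS : 0 ≤ S) (h : WellConditioned c S R) (i : Fin n) :
    ∑ j, |R⁻¹ i j| ≤ invBound c S := by
  classical
  set w : Fin n → ℝ := R⁻¹.mulVec (Pi.single i 1) with hw
  set d : Fin n → ℝ := fun j => 1 + |(j : ℝ) - i| with hd
  have hw' : ∀ j, w j = R⁻¹ j i := fun j => by simp [hw]
  have e1 : l2 (Pi.single i (1 : ℝ) : Fin n → ℝ) = 1 := by
    rw [← sq_eq_sq₀ (l2_nonneg _) zero_le_one, l2_sq, Finset.sum_eq_single i] <;> simp +contextual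
  have e2 : d * (Pi.single i (1 : ℝ) : Fin n → ℝ) = Pi.single i 1 := by
    ext j
    by_cases hj : j = i
    · subst hj; simp [hd]
    · simp [hj]
  have h1 : l2 w ≤ 1 / c := by
    have := h.l2_inv_mulVec_le hc (Pi.single i 1)
    rwa [e1] at this
  have h2 : c * l2 (d * w) ≤ 1 + S * l2 w := by
    have := h.l2_weight_mul_le hS (d := d) (fun a b => by
      simp only [hd]
      have := abs_abs_sub_abs_le_abs_sub ((a : ℝ) - i) ((b : ℝ) - i)
      simpa using this) w
    rwa [hw, h.mulVec_inv hc, e2, e1] at this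
  have h3 : l2 (d * w) ≤ (1 + S / c) / c := by
    rw [le_div_iff₀' hc]
    refine h2.trans ?_
    have := mul_le_mul_of_nonneg_left h1 hS
    rw [mul_one_div] at this
    linarith
  have hdpos : ∀ j, 0 < d j := fun j => by simp only [hd]; positivity
  have h4 : l2 (fun j => (d j)⁻¹) ≤ Real.sqrt (2 * ∑' k : ℕ, (1 + (k : ℝ))⁻¹ ^ 2) := by
    refine l2_le_of_sq_le (Real.sqrt_nonneg _) ?_
    rw [Real.sq_sqrt (mul_nonneg zero_le_two (tsum_nonneg fun k => by positivity))]
    have := sum_fin_dist_le (g := fun k : ℕ => (1 + (k : ℝ))⁻¹ ^ 2) (fun k => by positivity)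
      summable_inv_sq i
    refine le_trans (le_of_eq ?_) this
    refine Finset.sum_congr rfl fun j _ => ?_
    simp only [hd, natDist_cast, abs_sub_comm]
  calc ∑ j, |R⁻¹ i j| = ∑ j, |(d * w) j| * |(d j)⁻¹| := by
        refine Finset.sum_congr rfl fun j _ => ?_
        rw [← abs_mul, abs_symm h.inv_symm, ← hw', Pi.mul_apply, mul_comm (d j), mul_assoc,
          mul_inv_cancel₀ (hdpos j).ne', mul_one]
    _ ≤ l2 (d * w) * l2 (fun j => (d j)⁻¹) := sum_abs_mul_abs_le _ _
    _ ≤ invBound c S := mul_le_mul h3 h4 (l2_nonneg _) (by positivity)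

lemma inv_col (hc : 0 < c) (hS : 0 ≤ S) (h : WellConditioned c S R) (j : Fin n) :
    ∑ i, |R⁻¹ i j| ≤ invBound c S := by
  simpa only [abs_symm h.inv_symm _ j] using h.inv_row hc hS j

lemma inv_sub_inv (hc : 0 < c) (h : WellConditioned c S R) (h' : WellConditioned c S R') :
    R⁻¹ - R'⁻¹ = R⁻¹ * (R' - R) * R'⁻¹ := by
  have u := (Matrix.isUnit_iff_isUnit_det _).1 (h.posDef hc).isUnit
  have u' := (Matrix.isUnit_iff_isUnit_det _).1 (h'.posDef hc).isUnit
  rw [mul_sub, Matrix.nonsing_inv_mul _ u, sub_mul, mul_assoc, Matrix.mul_nonsing_inv _ u', mul_one,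
    one_mul]

end WellConditioned

/-! ### Sensitivity of inverse quadratic forms and traces to the matrix. -/

section L2

variable {ι κ : Type*} [Fintype ι] [Fintype κ]

lemma sum_sq_mul_le_sqrt (u δ : ι → ℝ) :
    ∑ i, u i ^ 2 * δ i ≤ Real.sqrt (∑ i, u i ^ 4) * Real.sqrt (∑ i, δ i ^ 2) := by
  have := Real.sum_mul_le_sqrt_mul_sqrt Finset.univ (fun i => u i ^ 2) δ
  simpa only [← pow_mul] using this

lemma abs_dotProduct_mulVec_le_half (D : Matrix ι κ ℝ) (u : ι → ℝ) (v : κ → ℝ) :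
    |u ⬝ᵥ D.mulVec v| ≤ (∑ i, u i ^ 2 * ∑ j, |D i j|) / 2 + (∑ j, v j ^ 2 * ∑ i, |D i j|) / 2 := by
  have h1 : |u ⬝ᵥ D.mulVec v| ≤ ∑ i, ∑ j, |D i j| * (|u i| * |v j|) := by
    simp only [dotProduct, Matrix.mulVec, Finset.mul_sum]
    refine (Finset.abs_sum_le_sum_abs _ _).trans (Finset.sum_le_sum fun i _ => ?_)
    refine (Finset.abs_sum_le_sum_abs _ _).trans (Finset.sum_le_sum fun j _ => le_of_eq ?_)
    rw [abs_mul, abs_mul]; ring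
  have h2 : ∑ i, ∑ j, |D i j| * (|u i| * |v j|)
      ≤ ∑ i, ∑ j, (u i ^ 2 * |D i j| / 2 + v j ^ 2 * |D i j| / 2) := by
    refine Finset.sum_le_sum fun i _ => Finset.sum_le_sum fun j _ => ?_
    have := two_mul_le_add_sq (|u i|) (|v j|)
    rw [sq_abs, sq_abs] at this
    nlinarith [mul_le_mul_of_nonneg_left this (abs_nonneg (D i j))]
  refine (h1.trans h2).trans (le_of_eq ?_)
  simp only [Finset.sum_add_distrib, ← Finset.sum_div, ← Finset.mul_sum]
  rw [Finset.sum_comm (f := fun i j => v j ^ 2 * |D i j|)]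
  simp only [← Finset.mul_sum]

end L2

namespace WellConditioned

variable {c S : ℝ} {n : ℕ} {R R' R₀ : Matrix (Fin n) (Fin n) ℝ}

lemma sqrt_sum_inv_mulVec_pow_four_le (hc : 0 < c) (hS : 0 ≤ S) (h : WellConditioned c S R)
    (y : Fin n → ℝ) : Real.sqrt (∑ i, (R⁻¹.mulVec y i) ^ 4)
      ≤ invBound c S ^ 2 * Real.sqrt (∑ i, y i ^ 4) := by
  have hB : 0 ≤ invBound c S := mul_nonneg (by positivity) (Real.sqrt_nonneg _)
  rw [← Real.sqrt_sq (sq_nonneg (invBound c S)), ← Real.sqrt_mul (by positivity)]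
  refine Real.sqrt_le_sqrt ?_
  have := sum_pow_four_mulVec_le hB (h.inv_row hc hS) (h.inv_col hc hS) y
  rwa [← pow_mul]

lemma sum_abs_sub_row_le (h : WellConditioned c S R) (h' : WellConditioned c S R') (i : Fin n) :
    ∑ j, |(R' - R) i j| ≤ 2 * S := by
  refine (Finset.sum_le_sum fun j _ => ?_).trans
    ((Finset.sum_add_distrib (f := fun j => |R' i j|) (g := fun j => |R i j|)).trans_le ?_)
  · exact abs_sub _ _
  · linarith [h.row i, h'.row i]

/-- Two inverse quadratic forms are close when the matrices are close entrywise in mean. -/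
lemma abs_quadForm_inv_sub_le (hc : 0 < c) (hS : 0 ≤ S) (h : WellConditioned c S R)
    (h' : WellConditioned c S R') (y : Fin n → ℝ) :
    |y ⬝ᵥ R⁻¹.mulVec y - y ⬝ᵥ R'⁻¹.mulVec y| ≤ invBound c S ^ 2 * Real.sqrt (∑ i, y i ^ 4)
      * Real.sqrt (2 * S * ∑ i, ∑ j, |R i j - R' i j|) := by
  set D := R' - R with hD
  have e1 : y ⬝ᵥ R⁻¹.mulVec y - y ⬝ᵥ R'⁻¹.mulVec y
      = R⁻¹.mulVec y ⬝ᵥ D.mulVec (R'⁻¹.mulVec y) := by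
    rw [← dotProduct_sub, ← Matrix.sub_mulVec, inv_sub_inv hc h h', Matrix.dotProduct_mulVec,
      Matrix.mul_assoc, ← Matrix.vecMul_vecMul, ← Matrix.dotProduct_mulVec, ← Matrix.mulVec_mulVec]
    congr 1
    have ht : R⁻¹ᵀ = R⁻¹ := by
      have := h.inv_symm.eq
      rwa [Matrix.conjTranspose_eq_transpose_of_trivial] at this
    rw [← Matrix.vecMul_transpose, ht]
  have hDs : D.IsHermitian := h'.symm.sub h.symm
  have key : ∀ {Q : Matrix (Fin n) (Fin n) ℝ}, WellConditioned c S Q →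
      ∑ i, (Q⁻¹.mulVec y i) ^ 2 * ∑ j, |D i j| ≤ invBound c S ^ 2 * Real.sqrt (∑ i, y i ^ 4)
      * Real.sqrt (2 * S * ∑ i, ∑ j, |D i j|) := fun {Q} hQ => by
    refine (sum_sq_mul_le_sqrt _ _).trans (mul_le_mul
      (hQ.sqrt_sum_inv_mulVec_pow_four_le hc hS y) (Real.sqrt_le_sqrt ?_) (Real.sqrt_nonneg _)
      (by positivity))
    -- A row sum of `|D|` is at most `2 * S`, so its square is at most `2 * S` times itself:
    -- entrywise `ℓ¹` closeness controls the `ℓ²` norm of the row sums.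
    rw [Finset.mul_sum]
    refine Finset.sum_le_sum fun i _ => ?_
    rw [sq]
    exact mul_le_mul_of_nonneg_right (sum_abs_sub_row_le h h' i)
      (Finset.sum_nonneg fun j _ => abs_nonneg _)
  have e2 : ∑ i, ∑ j, |R i j - R' i j| = ∑ i, ∑ j, |D i j| := by
    simp [hD, abs_sub_comm]
  rw [e1, e2]
  refine (abs_dotProduct_mulVec_le_half _ _ _).trans ?_
  have h3 := key h
  have h4 := key h'
  have e3 : ∀ j, ∑ i, |D i j| = ∑ i, |D j i| := fun j =>
    Finset.sum_congr rfl fun i _ => abs_symm hDs i j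
  simp only [e3]
  linarith

/-- The resolvent identity writes the difference as a pairing of `D = R' - R` with a matrix whose
entries are bounded by products of row and column sums. -/
lemma abs_trace_inv_sub_mul_le (hc : 0 < c) (hS : 0 ≤ S) (h : WellConditioned c S R)
    (h' : WellConditioned c S R') (h₀ : WellConditioned c S R₀) :
    |(R⁻¹ * R₀).trace - (R'⁻¹ * R₀).trace|
      ≤ invBound c S ^ 2 * S * ∑ i, ∑ j, |R i j - R' i j| := by
  set D := R' - R with hD
  have hB : 0 ≤ invBound c S := mul_nonneg (by positivity) (Real.sqrt_nonneg _)
  set T := R'⁻¹ * R₀ with hT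
  have hTb : ∀ j k, |T j k| ≤ invBound c S * S := fun j k => by
    rw [hT, Matrix.mul_apply]
    refine (Finset.abs_sum_le_sum_abs _ _).trans ?_
    calc ∑ l, |R'⁻¹ j l * R₀ l k| ≤ ∑ l, |R'⁻¹ j l| * S := by
          refine Finset.sum_le_sum fun l _ => ?_
          rw [abs_mul]
          refine mul_le_mul_of_nonneg_left ?_ (abs_nonneg _)
          exact (Finset.single_le_sum (f := fun k => |R₀ l k|) (fun _ _ => abs_nonneg _)
            (Finset.mem_univ k)).trans (h₀.row l)
      _ ≤ _ := by
          rw [← Finset.sum_mul]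
          exact mul_le_mul_of_nonneg_right (h'.inv_row hc hS j) hS
  have e1 : (R⁻¹ * R₀).trace - (R'⁻¹ * R₀).trace = ∑ i, ∑ j, D i j * ∑ k, R⁻¹ k i * T j k := by
    rw [← Matrix.trace_sub, ← sub_mul, inv_sub_inv hc h h', Matrix.mul_assoc, ← hT, ← hD,
      Matrix.mul_assoc, Matrix.trace_mul_comm, Matrix.trace]
    simp only [Matrix.diag_apply, Matrix.mul_apply, Finset.sum_mul, Finset.mul_sum]
    refine Finset.sum_congr rfl fun i _ => ?_
    rw [Finset.sum_comm]
    exact Finset.sum_congr rfl fun j _ => Finset.sum_congr rfl fun k _ => by ring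
  have e2 : ∑ i, ∑ j, |R i j - R' i j| = ∑ i, ∑ j, |D i j| := by
    simp [hD, abs_sub_comm]
  rw [e1, e2, Finset.mul_sum]
  refine (Finset.abs_sum_le_sum_abs _ _).trans (Finset.sum_le_sum fun i _ => ?_)
  rw [Finset.mul_sum]
  refine (Finset.abs_sum_le_sum_abs _ _).trans (Finset.sum_le_sum fun j _ => ?_)
  rw [abs_mul, mul_comm]
  refine mul_le_mul_of_nonneg_right ?_ (abs_nonneg _)
  refine (Finset.abs_sum_le_sum_abs _ _).trans ?_
  calc ∑ k, |R⁻¹ k i * T j k| ≤ ∑ k, |R⁻¹ k i| * (invBound c S * S) := by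
        refine Finset.sum_le_sum fun k _ => ?_
        rw [abs_mul]
        exact mul_le_mul_of_nonneg_left (hTb j k) (abs_nonneg _)
    _ ≤ _ := by
        rw [← Finset.sum_mul]
        have := mul_le_mul_of_nonneg_right (h.inv_col hc hS i) (mul_nonneg hB hS)
        linarith

end WellConditioned

/-! ### Gaussian divergence against Frobenius distance. -/

open scoped MatrixOrder Matrix.Norms.L2Operator in
/-- Simultaneous diagonalisation of a positive definite and a symmetric matrix. -/
lemma exists_simultaneous_diagonalization {n : ℕ} {A N : Matrix (Fin n) (Fin n) ℝ}
    (hA : A.PosDef) (hN : N.IsHermitian) :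
    ∃ (V : Matrix (Fin n) (Fin n) ℝ) (l : Fin n → ℝ),
      V * Vᵀ = A ∧ Vᵀ * N * V = Matrix.diagonal l := by
  obtain ⟨B, hB⟩ := CStarAlgebra.nonneg_iff_eq_star_mul_self.1 hA.posSemidef.nonneg
  rw [Matrix.star_eq_conjTranspose, Matrix.conjTranspose_eq_transpose_of_trivial] at hB
  have hN' : (B * N * Bᵀ).IsHermitian := by
    have := Matrix.isHermitian_mul_mul_conjTranspose B hN
    rwa [Matrix.conjTranspose_eq_transpose_of_trivial] at this
  set U : Matrix (Fin n) (Fin n) ℝ := (hN'.eigenvectorUnitary : Matrix (Fin n) (Fin n) ℝ) with hU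
  have hs := hN'.spectral_theorem
  rw [Unitary.conjStarAlgAut_apply] at hs
  have u1 : Uᵀ * U = 1 := by
    have := Unitary.coe_star_mul_self hN'.eigenvectorUnitary
    rwa [Matrix.star_eq_conjTranspose, Matrix.conjTranspose_eq_transpose_of_trivial] at this
  have u2 : U * Uᵀ = 1 := mul_eq_one_comm.1 u1
  rw [Matrix.star_eq_conjTranspose, Matrix.conjTranspose_eq_transpose_of_trivial, ← hU] at hs
  refine ⟨Bᵀ * U, hN'.eigenvalues, ?_, ?_⟩
  · rw [Matrix.transpose_mul, Matrix.transpose_transpose, Matrix.mul_assoc, ← Matrix.mul_assoc U,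
      u2, Matrix.one_mul, hB]
  · rw [Matrix.transpose_mul, Matrix.transpose_transpose]
    calc Uᵀ * B * N * (Bᵀ * U) = Uᵀ * (B * N * Bᵀ) * U := by simp only [Matrix.mul_assoc]
      _ = (Uᵀ * U) * Matrix.diagonal (RCLike.ofReal ∘ hN'.eigenvalues) * (Uᵀ * U) := by
          conv_lhs => rw [hs]
          simp only [Matrix.mul_assoc]
      _ = _ := by rw [u1, Matrix.one_mul, Matrix.mul_one]; rfl

lemma sum_sq_mul_le {n : ℕ} {V : Matrix (Fin n) (Fin n) ℝ} {s : ℝ}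
    (hV : ∀ x, l2 (V.mulVec x) ^ 2 ≤ s * l2 x ^ 2) (M : Matrix (Fin n) (Fin n) ℝ) :
    ∑ i, ∑ j, (V * M) i j ^ 2 ≤ s * ∑ i, ∑ j, M i j ^ 2 := by
  rw [Finset.sum_comm, Finset.sum_comm (f := fun i j => M i j ^ 2), Finset.mul_sum]
  refine Finset.sum_le_sum fun j _ => ?_
  have := hV (fun i => M i j)
  rw [l2_sq, l2_sq] at this
  exact this

/-- From `log x = 2 log √x ≤ 2(√x - 1)` one gets `(√x - 1)² ≤ x - 1 - log x`; the factor `√x + 1`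
relating `√x - 1` to `x - 1` is bounded on `(0, b]`. -/
lemma sub_one_sq_div_le {x b : ℝ} (hx : 0 < x) (hb : x ≤ b) :
    (x - 1) ^ 2 / (Real.sqrt b + 1) ^ 2 ≤ x - 1 - Real.log x := by
  have h1 : Real.log x ≤ 2 * (Real.sqrt x - 1) := by
    have := Real.log_le_sub_one_of_pos (Real.sqrt_pos.2 hx)
    rw [Real.log_sqrt hx.le] at this
    linarith
  have h2 : (Real.sqrt x - 1) ^ 2 ≤ x - 1 - Real.log x := by
    nlinarith [Real.sq_sqrt hx.le]
  refine le_trans ?_ h2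
  rw [div_le_iff₀ (by positivity)]
  have h3 : (x - 1) ^ 2 = (Real.sqrt x - 1) ^ 2 * (Real.sqrt x + 1) ^ 2 := by
    rw [← mul_pow]; congr 1; nlinarith [Real.sq_sqrt hx.le]
  rw [h3]
  have := Real.sqrt_le_sqrt hb
  gcongr

lemma l2_sq_transpose_mulVec {n : ℕ} {V A : Matrix (Fin n) (Fin n) ℝ} (hV : V * Vᵀ = A)
    (x : Fin n → ℝ) : l2 (Vᵀ.mulVec x) ^ 2 = x ⬝ᵥ A.mulVec x := by
  rw [l2_sq_eq_dotProduct, ← hV, ← Matrix.mulVec_mulVec, Matrix.dotProduct_mulVec x V,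
    Matrix.mulVec_transpose]

/-- A matrix and its transpose have the same operator norm. The case `V x = 0` is separate because
the argument divides by the norm of `V x`, and no sign of `s` is assumed. -/
lemma l2_sq_mulVec_le_of_transpose {n : ℕ} {V : Matrix (Fin n) (Fin n) ℝ} {s : ℝ}
    (hV : ∀ x, l2 (Vᵀ.mulVec x) ^ 2 ≤ s * l2 x ^ 2) (x : Fin n → ℝ) :
    l2 (V.mulVec x) ^ 2 ≤ s * l2 x ^ 2 := by
  set a := l2 (V.mulVec x) with ha
  have h1 : a ^ 2 ≤ l2 x * l2 (Vᵀ.mulVec (V.mulVec x)) := by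
    rw [ha, l2_sq_eq_dotProduct, Matrix.dotProduct_mulVec, ← Matrix.mulVec_transpose,
      dotProduct_comm]
    exact (le_abs_self _).trans (abs_dotProduct_le _ _)
  have h2 := hV (V.mulVec x)
  rw [← ha] at h2
  rcases (l2_nonneg (V.mulVec x)).eq_or_lt with h0 | h0
  · rw [← ha] at h0
    by_contra hcon
    push Not at hcon
    have h3 := hV x
    rcases (l2_nonneg x).eq_or_lt with h4 | h4
    · rw [← h0, ← h4] at hcon; simp at hcon
    · rw [← h0] at hcon
      nlinarith [sq_nonneg (l2 (Vᵀ.mulVec x))]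
  · rw [← ha] at h0
    have h3 : (a ^ 2) ^ 2 ≤ l2 x ^ 2 * (s * a ^ 2) :=
      calc (a ^ 2) ^ 2 ≤ (l2 x * l2 (Vᵀ.mulVec (V.mulVec x))) ^ 2 :=
            pow_le_pow_left₀ (sq_nonneg _) h1 2
        _ = l2 x ^ 2 * l2 (Vᵀ.mulVec (V.mulVec x)) ^ 2 := by ring
        _ ≤ _ := mul_le_mul_of_nonneg_left h2 (sq_nonneg _)
    have h4 : 0 < a ^ 2 := by positivity
    exact le_of_mul_le_mul_right (by nlinarith) h4

namespace WellConditioned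

variable {c S : ℝ} {n : ℕ} {R R' R₀ : Matrix (Fin n) (Fin n) ℝ}

lemma quadForm_le (hS : 0 ≤ S) (h : WellConditioned c S R) (x : Fin n → ℝ) :
    x ⬝ᵥ R.mulVec x ≤ S * l2 x ^ 2 := by
  refine ((le_abs_self _).trans (abs_dotProduct_le _ _)).trans ?_
  have := mul_le_mul_of_nonneg_left (l2_mulVec_le hS h.row h.col x) (l2_nonneg x)
  nlinarith

/-- The constant in the lower bound of the Gaussian divergence by the Frobenius distance. -/
def _root_.Kriging.klConst (c S : ℝ) : ℝ := (S ^ 2 * (Real.sqrt (S / c) + 1) ^ 2)⁻¹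

/-- The Gaussian Kullback-Leibler divergence controls the Frobenius distance. -/
lemma klConst_mul_le (hc : 0 < c) (hS : 0 < S) (h : WellConditioned c S R)
    (h₀ : WellConditioned c S R₀) :
    klConst c S * ∑ i, ∑ j, (R i j - R₀ i j) ^ 2
      ≤ Real.log R.det - Real.log R₀.det + (R⁻¹ * R₀).trace - n := by
  have hsym : (R⁻¹ * R₀ * R⁻¹).IsHermitian := by
    have := Matrix.isHermitian_mul_mul_conjTranspose R⁻¹ h₀.symm
    rwa [h.inv_symm.eq] at this
  obtain ⟨V, l, hV, hl⟩ := exists_simultaneous_diagonalization (h.posDef hc) hsym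
  have uR := (Matrix.isUnit_iff_isUnit_det _).1 (h.posDef hc).isUnit
  have hdetR : R.det = V.det ^ 2 := by rw [← hV, Matrix.det_mul, Matrix.det_transpose, sq]
  have hRiT : R⁻¹ᵀ = R⁻¹ := by
    have := h.inv_symm.eq
    rwa [Matrix.conjTranspose_eq_transpose_of_trivial] at this
  have hVW : Vᵀ * (R⁻¹ * V) = 1 := by
    have h1 : V * (Vᵀ * R⁻¹) = 1 := by rw [← Matrix.mul_assoc, hV, Matrix.mul_nonsing_inv _ uR]
    rw [← Matrix.mul_assoc]
    exact mul_eq_one_comm.1 h1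
  -- The columns of `W` are `R`-orthonormal and diagonalise `R₀`, so the `l i` are the generalized
  -- eigenvalues of `R₀` relative to `R`; the divergence becomes `∑ (l i - 1 - log (l i))`.
  set W := R⁻¹ * V with hW
  have hWV : Wᵀ * V = 1 := by
    rw [hW, Matrix.transpose_mul, hRiT, Matrix.mul_assoc, ← hW, hVW]
  have hWR : Wᵀ * R₀ * W = Matrix.diagonal l := by
    rw [← hl, hW, Matrix.transpose_mul, hRiT]; simp only [Matrix.mul_assoc]
  have hR0 : V * Matrix.diagonal l * Vᵀ = R₀ := by
    calc V * Matrix.diagonal l * Vᵀ = (V * Vᵀ) * R⁻¹ * R₀ * (R⁻¹ * (V * Vᵀ)) := by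
          rw [← hl]; simp only [Matrix.mul_assoc]
      _ = R₀ := by rw [hV, Matrix.mul_nonsing_inv _ uR, Matrix.nonsing_inv_mul _ uR,
          Matrix.one_mul, Matrix.mul_one]
  have hq : ∀ (Q : Matrix (Fin n) (Fin n) ℝ) i,
      (Wᵀ * Q * W) i i = (fun k => W k i) ⬝ᵥ Q.mulVec (fun k => W k i) := fun Q i => by
    rw [Matrix.mul_assoc, Matrix.mul_apply]
    rfl
  have hone : ∀ i, (fun k => W k i) ⬝ᵥ R.mulVec (fun k => W k i) = 1 := fun i => by
    have hRW : R * W = V := by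
      rw [hW, ← Matrix.mul_assoc, Matrix.mul_nonsing_inv _ uR, Matrix.one_mul]
    rw [← hq, Matrix.mul_assoc, hRW, hWV, Matrix.one_apply_eq]
  have hlam : ∀ i, (fun k => W k i) ⬝ᵥ R₀.mulVec (fun k => W k i) = l i := fun i => by
    rw [← hq, hWR, Matrix.diagonal_apply_eq]
  have hpos : ∀ i, 0 < l i := fun i => by
    rw [← hlam]
    have hne : (fun k => W k i) ≠ 0 := fun h0 => by
      have := hone i
      rw [h0] at this
      simp at this
    simpa using (h₀.posDef hc).dotProduct_mulVec_pos hne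
  -- Rayleigh quotient: `R₀` is at most `S` and `R` at least `c` as quadratic forms.
  have hle : ∀ i, l i ≤ S / c := fun i => by
    have h1 := h.coercive (fun k => W k i)
    rw [hone i, ← l2_sq_eq_dotProduct] at h1
    have h2 := h₀.quadForm_le hS.le (fun k => W k i)
    rw [hlam i] at h2
    rw [le_div_iff₀ hc]
    nlinarith
  have hdetR0 : R₀.det = V.det ^ 2 * ∏ i, l i := by
    rw [← hR0, Matrix.det_mul, Matrix.det_mul, Matrix.det_transpose, Matrix.det_diagonal]; ring
  have hVdet : V.det ^ 2 ≠ 0 := by rw [← hdetR]; exact uR.ne_zero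
  have hlog : Real.log R₀.det = Real.log R.det + ∑ i, Real.log (l i) := by
    rw [hdetR0, hdetR, Real.log_mul hVdet (Finset.prod_ne_zero_iff.2 fun i _ => (hpos i).ne'),
      Real.log_prod fun i _ => (hpos i).ne']
  have htr : (R⁻¹ * R₀).trace = ∑ i, l i := by
    rw [← hR0, Matrix.mul_assoc, ← Matrix.mul_assoc, ← hW, ← Matrix.mul_assoc, Matrix.trace_mul_comm,
      ← Matrix.mul_assoc, hVW, Matrix.one_mul, Matrix.trace_diagonal]
  have hsum : ∑ i, (l i - 1) ^ 2 / (Real.sqrt (S / c) + 1) ^ 2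
      ≤ Real.log R.det - Real.log R₀.det + (R⁻¹ * R₀).trace - n := by
    refine (Finset.sum_le_sum fun i _ => sub_one_sq_div_le (hpos i) (hle i)).trans (le_of_eq ?_)
    rw [hlog, htr]
    simp only [Finset.sum_sub_distrib]
    simp
    ring
  refine le_trans ?_ hsum
  have hVt : ∀ x, l2 (Vᵀ.mulVec x) ^ 2 ≤ S * l2 x ^ 2 := fun x => by
    rw [l2_sq_transpose_mulVec hV]; exact h.quadForm_le hS.le x
  have hV' := l2_sq_mulVec_le_of_transpose hVt
  have hfrob : ∑ i, ∑ j, (R i j - R₀ i j) ^ 2 ≤ S * (S * ∑ i, (l i - 1) ^ 2) := by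
    have e : R₀ - R = V * (Matrix.diagonal (fun i => l i - 1) * Vᵀ) := by
      have : Matrix.diagonal (fun i => l i - 1) = Matrix.diagonal l - 1 := by
        rw [← Matrix.diagonal_one, Matrix.diagonal_sub]
      rw [this, sub_mul, mul_sub, Matrix.one_mul, hV, ← Matrix.mul_assoc, hR0]
    have e1 : ∑ i, ∑ j, (R i j - R₀ i j) ^ 2 = ∑ i, ∑ j, ((R₀ - R) i j) ^ 2 :=
      Finset.sum_congr rfl fun i _ => Finset.sum_congr rfl fun j _ => by
        rw [Matrix.sub_apply]; ring
    rw [e1, e]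
    refine (sum_sq_mul_le hV' _).trans (mul_le_mul_of_nonneg_left ?_ hS.le)
    have e2 : ∑ i, ∑ j, ((Matrix.diagonal (fun i => l i - 1) * Vᵀ) i j) ^ 2
        = ∑ i, ∑ j, ((V * Matrix.diagonal (fun i => l i - 1)) i j) ^ 2 := by
      rw [Finset.sum_comm]
      refine Finset.sum_congr rfl fun i _ => Finset.sum_congr rfl fun j _ => ?_
      rw [Matrix.diagonal_mul, Matrix.mul_diagonal, Matrix.transpose_apply, mul_comm]
    rw [e2]
    refine (sum_sq_mul_le hV' _).trans (le_of_eq ?_)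
    congr 1
    refine Finset.sum_congr rfl fun i _ => ?_
    rw [Finset.sum_eq_single i] <;> simp +contextual [eq_comm]
  rw [← Finset.sum_div, klConst, inv_mul_le_iff₀ (by positivity)]
  refine hfrob.trans (le_of_eq ?_)
  field_simp

end WellConditioned

/-- Coercivity from a lower bound of the spectrum. -/
lemma coercive_of_spectrum {n : ℕ} {R : Matrix (Fin n) (Fin n) ℝ} (hR : R.IsHermitian) {c : ℝ}
    (h : ∀ l ∈ spectrum ℝ R, c ≤ l) (v : Fin n → ℝ) : c * (v ⬝ᵥ v) ≤ v ⬝ᵥ R.mulVec v := by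
  have hH : (R - c • (1 : Matrix (Fin n) (Fin n) ℝ)).IsHermitian := by
    refine hR.sub ?_
    rw [Matrix.IsHermitian, Matrix.conjTranspose_smul]; simp
  have hp : (R - c • (1 : Matrix (Fin n) (Fin n) ℝ)).PosSemidef := by
    rw [Matrix.posSemidef_iff_isHermitian_and_spectrum_nonneg]
    refine ⟨hH, fun x hx => ?_⟩
    rw [← Algebra.algebraMap_eq_smul_one] at hx
    have : x + c ∈ spectrum ℝ R := by
      rw [spectrum.add_mem_iff]
      rwa [sub_eq_neg_add] at hx
    have := h _ this
    simpa using this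
  have := hp.dotProduct_mulVec_nonneg v
  rw [Matrix.sub_mulVec, dotProduct_sub, Matrix.smul_mulVec, Matrix.one_mulVec] at this
  simpa using this

/-! ### Couplings and lower bounds for the Wasserstein distance. -/

instance (μ : W2Space) : IsProbabilityMeasure μ.measure := μ.isProb

lemma isProbabilityMeasure_of_mem_couplings {μ ν : W2Space} {π : Measure (ℝ × ℝ)}
    (h : π ∈ couplings μ ν) : IsProbabilityMeasure π := by
  have : IsProbabilityMeasure (π.map Prod.fst) := by rw [h.1]; infer_instance
  exact Measure.isProbabilityMeasure_of_map (f := Prod.fst)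

lemma prod_mem_couplings (μ ν : W2Space) : μ.measure.prod ν.measure ∈ couplings μ ν := by
  constructor <;> simp

instance (μ ν : W2Space) : Nonempty (couplings μ ν) := ⟨⟨_, prod_mem_couplings μ ν⟩⟩

lemma integral_comp_fst {μ ν : W2Space} {π : Measure (ℝ × ℝ)} (h : π ∈ couplings μ ν) {f : ℝ → ℝ}
    (hf : Integrable f μ.measure) :
    Integrable (fun z : ℝ × ℝ => f z.1) π ∧ ∫ z, f z.1 ∂π = ∫ x, f x ∂μ.measure := by
  rw [← h.1] at hf ⊢
  exact ⟨hf.comp_measurable measurable_fst,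
    (integral_map measurable_fst.aemeasurable hf.aestronglyMeasurable).symm⟩

lemma integral_comp_snd {μ ν : W2Space} {π : Measure (ℝ × ℝ)} (h : π ∈ couplings μ ν) {f : ℝ → ℝ}
    (hf : Integrable f ν.measure) :
    Integrable (fun z : ℝ × ℝ => f z.2) π ∧ ∫ z, f z.2 ∂π = ∫ x, f x ∂ν.measure := by
  rw [← h.2] at hf ⊢
  exact ⟨hf.comp_measurable measurable_snd,
    (integral_map measurable_snd.aemeasurable hf.aestronglyMeasurable).symm⟩

lemma integrable_cost {μ ν : W2Space} {π : Measure (ℝ × ℝ)} (h : π ∈ couplings μ ν) :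
    Integrable (fun z : ℝ × ℝ => |z.1 - z.2| ^ 2) π := by
  have h1 := (integral_comp_fst h μ.secondMoment).1
  have h2 := (integral_comp_snd h ν.secondMoment).1
  refine ((h1.add h2).const_mul 2).mono' (by fun_prop) (ae_of_all _ fun z => ?_)
  simp only [Pi.add_apply, sq_abs, Real.norm_eq_abs, abs_of_nonneg (sq_nonneg (z.1 - z.2))]
  nlinarith [sq_nonneg (z.1 + z.2)]

lemma le_transportCost {μ ν : W2Space} {a : ℝ}
    (h : ∀ π ∈ couplings μ ν, a ≤ ∫ z : ℝ × ℝ, |z.1 - z.2| ^ 2 ∂π) : a ≤ transportCost μ ν :=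
  le_ciInf fun π => h π π.2

lemma transportCost_le {μ ν : W2Space} {π : Measure (ℝ × ℝ)} (h : π ∈ couplings μ ν) :
    transportCost μ ν ≤ ∫ z : ℝ × ℝ, |z.1 - z.2| ^ 2 ∂π := by
  refine ciInf_le (f := fun π : couplings μ ν =>
    ∫ z : ℝ × ℝ, |z.1 - z.2| ^ 2 ∂(π : Measure (ℝ × ℝ))) ⟨0, ?_⟩ ⟨π, h⟩
  rintro _ ⟨π, rfl⟩
  exact integral_nonneg fun z => by positivity

lemma transportCost_nonneg (μ ν : W2Space) : 0 ≤ transportCost μ ν :=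
  le_transportCost fun _ _ => integral_nonneg fun z => by positivity

lemma W2_nonneg (μ ν : W2Space) : 0 ≤ W2 μ ν := Real.sqrt_nonneg _

lemma W2_sq (μ ν : W2Space) : W2 μ ν ^ 2 = transportCost μ ν :=
  Real.sq_sqrt (transportCost_nonneg μ ν)

lemma ae_mem_of_support_subset {μ : W2Space} {s : Set ℝ} (h : μ.measure.support ⊆ s) :
    ∀ᵐ x ∂μ.measure, x ∈ s :=
  mem_of_superset (Measure.support_mem_ae) h

lemma ae_fst {μ ν : W2Space} {π : Measure (ℝ × ℝ)} (h : π ∈ couplings μ ν) {s : Set ℝ}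
    (hμ : ∀ᵐ x ∂μ.measure, x ∈ s) : ∀ᵐ z ∂π, z.1 ∈ s := by
  rw [← h.1] at hμ
  exact ae_of_ae_map measurable_fst.aemeasurable hμ

lemma ae_snd {μ ν : W2Space} {π : Measure (ℝ × ℝ)} (h : π ∈ couplings μ ν) {s : Set ℝ}
    (hν : ∀ᵐ x ∂ν.measure, x ∈ s) : ∀ᵐ z ∂π, z.2 ∈ s := by
  rw [← h.2] at hν
  exact ae_of_ae_map measurable_snd.aemeasurable hν

/-- Measures supported on translates of an interval are as far apart as the intervals. -/
lemma le_W2_of_support_subset {μ ν : W2Space} {a b L : ℝ}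
    (hμ : μ.measure.support ⊆ Set.Icc a (a + L)) (hν : ν.measure.support ⊆ Set.Icc b (b + L)) :
    |a - b| - L ≤ W2 μ ν := by
  rcases le_total (|a - b| - L) 0 with h0 | h0
  · exact h0.trans (W2_nonneg _ _)
  refine Real.le_sqrt_of_sq_le (le_transportCost fun π hπ => ?_)
  have := isProbabilityMeasure_of_mem_couplings hπ
  have h1 : ∫ _ : ℝ × ℝ, (|a - b| - L) ^ 2 ∂π ≤ ∫ z : ℝ × ℝ, |z.1 - z.2| ^ 2 ∂π := by
    refine integral_mono_ae (integrable_const _) (integrable_cost hπ) ?_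
    filter_upwards [ae_fst hπ (ae_mem_of_support_subset hμ),
      ae_snd hπ (ae_mem_of_support_subset hν)] with z hz1 hz2
    refine pow_le_pow_left₀ h0 ?_ 2
    rw [Set.mem_Icc] at hz1 hz2
    rcases abs_cases (a - b) with h | h <;> rcases abs_cases (z.1 - z.2) with h' | h' <;> linarith
  simpa using h1

/-- A measure supported far from the origin is far from a given measure. -/
lemma exists_le_W2_of_support_subset (μ : W2Space) :
    ∃ b : ℝ, ∀ (ν : W2Space) (k : ℝ), 0 ≤ k → ν.measure.support ⊆ Set.Ici k →
      k / 2 - b ≤ W2 μ ν := by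
  refine ⟨Real.sqrt (∫ x, x ^ 2 ∂μ.measure), fun ν k hk hν => ?_⟩
  set M := ∫ x, x ^ 2 ∂μ.measure with hM
  have hM0 : 0 ≤ M := integral_nonneg fun x => sq_nonneg x
  rcases le_total (k / 2 - Real.sqrt M) 0 with h0 | h0
  · exact h0.trans (W2_nonneg _ _)
  -- Pointwise `(x - y)² ≥ y²/2 - x²`, with `y ≥ k`, gives cost at least `k²/2 - M`; this exceeds
  -- `(k/2 - √M)²` once `k/2 ≥ √M`.
  refine Real.le_sqrt_of_sq_le (le_trans (b := k ^ 2 / 2 - M) ?_ (le_transportCost fun π hπ => ?_))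
  · nlinarith [Real.sq_sqrt hM0, Real.sqrt_nonneg M]
  have := isProbabilityMeasure_of_mem_couplings hπ
  obtain ⟨hi, he⟩ := integral_comp_fst hπ μ.secondMoment
  have h1 : ∫ z : ℝ × ℝ, (k ^ 2 / 2 - z.1 ^ 2) ∂π ≤ ∫ z : ℝ × ℝ, |z.1 - z.2| ^ 2 ∂π := by
    refine integral_mono_ae ((integrable_const _).sub hi) (integrable_cost hπ) ?_
    filter_upwards [ae_snd hπ (ae_mem_of_support_subset hν)] with z hz
    rw [Set.mem_Ici] at hz
    simp only [sq_abs]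
    nlinarith [sq_nonneg (2 * z.1 - z.2)]
  rw [integral_sub (integrable_const _) hi, he] at h1
  simpa using h1

/-! ### Euclidean boxes inside the Wasserstein space, and monotonicity of the covariance. -/

section Clusters

variable {N : ℕ} [NeZero N]

/-- The uniform measure on `Fin N`. -/
def unifFin (N : ℕ) [NeZero N] : Measure (Fin N) := (PMF.uniformOfFintype (Fin N)).toMeasure

instance : IsProbabilityMeasure (unifFin N) := by unfold unifFin; infer_instance

lemma integral_unifFin (f : Fin N → ℝ) : ∫ k, f k ∂unifFin N = (N : ℝ)⁻¹ * ∑ k, f k := by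
  rw [unifFin, PMF.integral_eq_sum, Finset.mul_sum]
  simp

/-- The empirical measure of `N` real numbers. -/
def empirical (a : Fin N → ℝ) : W2Space where
  measure := (unifFin N).map a
  isProb := Measure.isProbabilityMeasure_map (measurable_of_finite _).aemeasurable
  secondMoment := by
    rw [integrable_map_measure (by fun_prop) (measurable_of_finite _).aemeasurable]
    exact Integrable.of_finite

/-- The distance between empirical measures whose points are paired with nearest neighbours. -/
lemma W2_empirical_sq {a b : Fin N → ℝ} (h : ∀ k l, |a l - b l| ≤ |a k - b l|) :
    W2 (empirical a) (empirical b) ^ 2 = (N : ℝ)⁻¹ * ∑ k, (a k - b k) ^ 2 := by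
  have ma : Measurable a := measurable_of_finite _
  have mb : Measurable b := measurable_of_finite _
  rw [W2_sq, ← integral_unifFin]
  refine le_antisymm ?_ (le_transportCost fun π hπ => ?_)
  · have hc : (unifFin N).map (fun k => (a k, b k)) ∈ couplings (empirical a) (empirical b) := by
      constructor
      · rw [Measure.map_map measurable_fst (ma.prodMk mb)]; rfl
      · rw [Measure.map_map measurable_snd (ma.prodMk mb)]; rfl
    refine (transportCost_le hc).trans (le_of_eq ?_)
    rw [integral_map (ma.prodMk mb).aemeasurable (by fun_prop)]
    simp
  -- Every coupling costs at least the mean squared distance from the second marginal to the range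
  -- of `a`, a quantity independent of the coupling. Pairing by index attains it under the
  -- nearest-neighbour hypothesis.
  · have hm : Measurable fun y : ℝ => Metric.infDist y (Set.range a) ^ 2 :=
      (Metric.continuous_infDist_pt _).measurable.pow_const 2
    have hi : Integrable (fun y : ℝ => Metric.infDist y (Set.range a) ^ 2)
        (empirical b).measure := by
      change Integrable _ ((unifFin N).map b)
      rw [integrable_map_measure hm.aestronglyMeasurable mb.aemeasurable]
      exact Integrable.of_finite
    obtain ⟨hi', he⟩ := integral_comp_snd hπ hi
    have h1 : ∫ z : ℝ × ℝ, Metric.infDist z.2 (Set.range a) ^ 2 ∂π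
        ≤ ∫ z : ℝ × ℝ, |z.1 - z.2| ^ 2 ∂π := by
      refine integral_mono_ae hi' (integrable_cost hπ) ?_
      have hae : ∀ᵐ x ∂(empirical a).measure, x ∈ Set.range a := by
        change ∀ᵐ x ∂((unifFin N).map a), x ∈ Set.range a
        refine (ae_map_iff ma.aemeasurable (Set.finite_range a).measurableSet).2 ?_
        exact ae_of_all _ fun k => Set.mem_range_self k
      filter_upwards [ae_fst hπ hae] with z hz
      refine pow_le_pow_left₀ Metric.infDist_nonneg ?_ 2
      have := Metric.infDist_le_dist_of_mem (x := z.2) hz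
      rwa [Real.dist_eq, abs_sub_comm] at this
    refine le_trans ?_ h1
    rw [he]
    change _ ≤ ∫ x, Metric.infDist x (Set.range a) ^ 2 ∂((unifFin N).map b)
    rw [integral_map mb.aemeasurable hm.aestronglyMeasurable]
    refine integral_mono Integrable.of_finite Integrable.of_finite fun l => ?_
    simp only
    rw [← sq_abs (a l - b l)]
    refine pow_le_pow_left₀ (abs_nonneg _) ?_ 2
    refine (Metric.le_infDist (Set.range_nonempty a)).2 ?_
    rintro _ ⟨k, rfl⟩
    rw [Real.dist_eq, abs_sub_comm (b l)]
    exact h k l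

end Clusters

/-- Bounded parts of every Euclidean space embed into `𝒲₂(ℝ)` up to scaling. -/
lemma exists_W2_embedding (κ : Type*) [Fintype κ] [Nonempty κ] (D : ℝ) :
    ∃ Φ : (κ → ℝ) → W2Space, ∀ a b : κ → ℝ, (∀ k, a k ∈ Set.Icc 0 D) → (∀ k, b k ∈ Set.Icc 0 D) →
      W2 (Φ a) (Φ b) ^ 2 = (Fintype.card κ : ℝ)⁻¹ * ∑ k, (a k - b k) ^ 2 := by
  have : NeZero (Fintype.card κ) := ⟨Fintype.card_ne_zero⟩
  let e := Fintype.equivFin κ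
  -- Coordinate `k` is placed in the block `[2Dk, 2Dk + D]`. Distinct blocks are at least `D` apart,
  -- so the nearest neighbour is always in the same block.
  refine ⟨fun a => empirical fun k => 2 * D * (k : ℝ) + a (e.symm k), fun a b ha hb => ?_⟩
  rw [W2_empirical_sq]
  · congr 1
    rw [← e.symm.sum_comp]
    exact Finset.sum_congr rfl fun k _ => by ring
  · intro k l
    rcases eq_or_ne k l with rfl | hkl
    · exact le_rfl
    have h1 := ha (e.symm k)
    have h2 := ha (e.symm l)
    have h3 := hb (e.symm l)
    rw [Set.mem_Icc] at h1 h2 h3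
    have hD : 0 ≤ D := h1.1.trans h1.2
    have h4 : |2 * D * (l : ℝ) + a (e.symm l) - (2 * D * (l : ℝ) + b (e.symm l))| ≤ D := by
      rw [abs_le]; constructor <;> linarith
    refine h4.trans ?_
    rcases lt_or_gt_of_ne hkl with h | h
    · have : (k : ℝ) + 1 ≤ l := by exact_mod_cast h
      refine le_trans ?_ (neg_le_abs _)
      nlinarith
    · have : (l : ℝ) + 1 ≤ k := by exact_mod_cast h
      refine le_trans ?_ (le_abs_self _)
      nlinarith

lemma IsCovarianceFunction.sum_nonneg {E : Type*} {K : E → E → ℝ} (hK : IsCovarianceFunction K)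
    {ι : Type*} [Fintype ι] (x : ι → E) (v : ι → ℝ) :
    0 ≤ ∑ i, ∑ j, v i * v j * K (x i) (x j) := by
  let e := Fintype.equivFin ι
  have h := (hK _ (x ∘ e.symm)).dotProduct_mulVec_nonneg (v ∘ e.symm)
  refine h.trans (le_of_eq ?_)
  rw [← e.symm.sum_comp]
  simp only [dotProduct, Matrix.mulVec, Matrix.of_apply, Finset.mul_sum, star_trivial,
    Function.comp_apply]
  refine Finset.sum_congr rfl fun i _ => ?_
  rw [← e.symm.sum_comp]
  exact Finset.sum_congr rfl fun j _ => by ring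

/-- A bounded function of the Wasserstein distance that is a covariance function is
nonincreasing. -/
lemma antitoneOn_of_isCovarianceFunction {f : ℝ → ℝ} {A : ℝ} (hA : ∀ t, 0 ≤ t → |f t| ≤ A)
    (hK : IsCovarianceFunction fun μ ν => f (W2 μ ν)) : AntitoneOn f (Set.Ici 0) := by
  -- Positivity pulled back to boxes of arbitrary dimension.
  have key : ∀ {κ : Type} [Fintype κ] [Nonempty κ] {D : ℝ} {ι : Type} [Fintype ι]
      (x : ι → κ → ℝ) (_ : ∀ i k, x i k ∈ Set.Icc 0 D) (v : ι → ℝ),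
      0 ≤ ∑ i, ∑ j, v i * v j * f (Real.sqrt ((Fintype.card κ : ℝ)⁻¹ * ∑ k, (x i k - x j k) ^ 2)) := by
    intro κ _ _ D ι _ x hx v
    obtain ⟨Φ, hΦ⟩ := exists_W2_embedding κ D
    refine (hK.sum_nonneg (fun i => Φ (x i)) v).trans (le_of_eq ?_)
    refine Finset.sum_congr rfl fun i _ => Finset.sum_congr rfl fun j _ => ?_
    rw [← hΦ _ _ (hx i) (hx j), Real.sqrt_sq (W2_nonneg _ _)]
  have h0 : ∀ t, 0 ≤ t → f t ≤ f 0 := fun t ht => by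
    have := key (κ := Unit) (D := t) (ι := Bool) (fun i _ => if i then t else 0)
      (fun i k => by cases i <;> simp [ht]) (fun i => if i then 1 else -1)
    simp [Real.sqrt_sq ht] at this
    linarith
  intro t ht t' ht' htt'
  rw [Set.mem_Ici] at ht ht'
  rcases ht.eq_or_lt with rfl | htpos
  · exact h0 t' ht'
  by_contra hcon
  push Not at hcon
  -- Positivity is tested on a regular simplex of `m + 1` points at mutual distance `t`, times a
  -- pair at distance `r = √(t'² - t²)` carrying signs `±1`. Pairs over the same simplex vertex
  -- contribute `f 0 - f r`, at most `2 * A`, and the others `m (f t - f t')`; a large `m`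
  -- contradicts `f t < f t'`.
  obtain ⟨m, hm⟩ := exists_nat_gt (2 * A / (f t' - f t))
  rw [div_lt_iff₀ (by linarith)] at hm
  set r := Real.sqrt (t' ^ 2 - t ^ 2) with hr
  have hrsq : r ^ 2 = t' ^ 2 - t ^ 2 := Real.sq_sqrt (by nlinarith)
  have hr0 : 0 ≤ r := Real.sqrt_nonneg _
  -- This scale compensates the factor `1 / card` in the embedding and the `2` in the squared
  -- simplex distance.
  set c : ℝ := Real.sqrt ((m + 1 + 2 : ℝ) / 2) with hc
  have hc0 : 0 ≤ c := Real.sqrt_nonneg _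
  have hcsq : c ^ 2 = (m + 1 + 2 : ℝ) / 2 := Real.sq_sqrt (by positivity)
  have hcard : (Fintype.card (Fin (m + 1) ⊕ Bool) : ℝ) = m + 1 + 2 := by simp
  let x : Fin (m + 1) × Bool → Fin (m + 1) ⊕ Bool → ℝ := fun p =>
    Sum.elim (fun k => if k = p.1 then c * t else 0) (fun s => if s = p.2 then c * r else 0)
  have hx : ∀ p k, x p k ∈ Set.Icc 0 (c * t + c * r) := fun p k => by
    have h1 : 0 ≤ c * t := by positivity
    have h2 : 0 ≤ c * r := by positivity
    rcases k with k | s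
    · simp only [x, Sum.elim_inl]; split_ifs <;> constructor <;> linarith
    · simp only [x, Sum.elim_inr]; split_ifs <;> constructor <;> linarith
  have hd1 : ∀ i j : Fin (m + 1), ∑ k, ((if k = i then c * t else 0) - if k = j then c * t else 0) ^ 2
      = if i = j then 0 else 2 * (c * t) ^ 2 := fun i j => by
    split_ifs with hij
    · subst hij; simp
    · have : ∀ k, ((if k = i then c * t else 0) - if k = j then c * t else 0) ^ 2
          = (if k = i then (c * t) ^ 2 else 0) + if k = j then (c * t) ^ 2 else 0 := fun k => by
        by_cases h1 : k = i
        · simp [h1, hij]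
        · by_cases h2 : k = j
          · have h3 : j ≠ i := fun h => hij (Eq.symm h)
            simp [h2, h3]
          · simp [h1, h2]
      simp only [this, Finset.sum_add_distrib]
      simp; ring
  have hdist : ∀ i j s s', Real.sqrt ((Fintype.card (Fin (m + 1) ⊕ Bool) : ℝ)⁻¹
      * ∑ k, (x (i, s) k - x (j, s') k) ^ 2)
      = if i = j then (if s = s' then 0 else r) else (if s = s' then t else t') := by
    intro i j s s'
    rw [hcard, Fintype.sum_sum_type]
    simp only [x, Sum.elim_inl, Sum.elim_inr]
    rw [hd1]
    have hm3 : (m + 1 + 2 : ℝ) ≠ 0 := by positivity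
    have e1 : (m + 1 + 2 : ℝ)⁻¹ * (2 * (c * t) ^ 2) = t ^ 2 := by
      rw [mul_pow, hcsq]; field_simp
    have e2 : (m + 1 + 2 : ℝ)⁻¹ * (2 * (c * r) ^ 2) = r ^ 2 := by
      rw [mul_pow, hcsq]; field_simp
    have hss : s ≠ s' → ∑ k : Bool, ((if k = s then c * r else 0) - if k = s' then c * r else 0) ^ 2
        = 2 * (c * r) ^ 2 := fun h => by
      cases s <;> cases s' <;> simp at h ⊢ <;> ring
    by_cases hij : i = j <;> by_cases hs : s = s'
    · simp [hij, hs]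
    · rw [hss hs, if_pos hij, if_pos hij, if_neg hs, zero_add, e2, Real.sqrt_sq hr0]
    · simp only [hij, hs, if_true, if_false, sub_self]
      simp [e1, Real.sqrt_sq ht]
    · rw [hss hs, if_neg hij, if_neg hij, if_neg hs, mul_add, e1, e2, hrsq, add_sub_cancel,
        Real.sqrt_sq ht']
  have h := key x hx (fun p => if p.2 then 1 else -1)
  simp only [Fintype.sum_prod_type, hdist] at h
  have hin : ∀ i : Fin (m + 1), ∀ j : Fin (m + 1),
      ∑ s : Bool, ∑ s' : Bool, (if s then (1 : ℝ) else -1) * (if s' then 1 else -1)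
        * f (if i = j then (if s = s' then 0 else r) else (if s = s' then t else t'))
      = (if i = j then 2 * (f 0 - f r) - 2 * (f t - f t') else 0) + 2 * (f t - f t') := by
    intro i j
    split_ifs <;> simp <;> ring
  have h' : 0 ≤ ∑ i : Fin (m + 1), ∑ j : Fin (m + 1),
      ((if i = j then 2 * (f 0 - f r) - 2 * (f t - f t') else 0) + 2 * (f t - f t')) := by
    refine h.trans (le_of_eq (Finset.sum_congr rfl fun i _ => ?_))
    rw [Finset.sum_comm]
    exact Finset.sum_congr rfl fun j _ => hin i j
  simp [Finset.sum_add_distrib] at h'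
  have h1 := abs_le.1 (hA 0 le_rfl)
  have h2 := abs_le.1 (hA r hr0)
  have h3 : 0 ≤ (f 0 - f r) + m * (f t - f t') := by
    have : (0 : ℝ) < m + 1 := by positivity
    by_contra hn
    push Not at hn
    nlinarith
  nlinarith

/-! ### Moments of quadratic forms in Gaussian vectors. -/

/-- The fourth moment of the standard Gaussian distribution. -/
def gaussFourth : ℝ := ∫ x, x ^ 4 ∂gaussianReal 0 1

lemma gaussFourth_nonneg : 0 ≤ gaussFourth := integral_nonneg fun x => by positivity

section Gaussian

variable {Ω : Type*} [MeasurableSpace Ω] {P : Measure Ω}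

lemma integrable_pow_four {X : Ω → ℝ} (hX : HasGaussianLaw X P) :
    Integrable (fun ω => X ω ^ 4) P := by
  have := (hX.memLp (p := 4) (by norm_num)).integrable_norm_pow (p := 4) (by norm_num)
  refine this.congr (ae_of_all _ fun ω => ?_)
  simp only [Real.norm_eq_abs]
  exact (even_two_mul 2).pow_abs _

lemma integral_pow_four {X : Ω → ℝ} (hX : HasGaussianLaw X P) (h0 : ∫ ω, X ω ∂P = 0) {v : ℝ}
    (hv : covariance X X P = v) : ∫ ω, X ω ^ 4 ∂P = v ^ 2 * gaussFourth := by
  have hm := hX.aemeasurable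
  rw [covariance_self hm] at hv
  have hv0 : 0 ≤ v := hv ▸ variance_nonneg _ _
  have h1 := hX.map_eq_gaussianReal
  rw [h0, hv] at h1
  have h2 : gaussianReal 0 v.toNNReal = (gaussianReal 0 1).map (Real.sqrt v * ·) := by
    rw [gaussianReal_map_const_mul]
    congr 1
    · simp
    · ext; simp [Real.sq_sqrt hv0, Real.coe_toNNReal _ hv0]
  calc ∫ ω, X ω ^ 4 ∂P = ∫ x, x ^ 4 ∂(P.map X) :=
        (integral_map (f := fun x : ℝ => x ^ 4) hm (by fun_prop)).symm
    _ = ∫ x, (Real.sqrt v * x) ^ 4 ∂gaussianReal 0 1 := by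
        rw [h1, h2, integral_map (by fun_prop) (by fun_prop)]
    _ = _ := by
        simp only [mul_pow]
        rw [integral_const_mul, show Real.sqrt v ^ 4 = (Real.sqrt v ^ 2) ^ 2 by ring,
          Real.sq_sqrt hv0]
        rfl

lemma memLp_sq {X : Ω → ℝ} (hX : HasGaussianLaw X P) : MemLp (fun ω => X ω ^ 2) 2 P := by
  have hm : AEMeasurable X P := hX.aemeasurable
  rw [memLp_two_iff_integrable_sq (hm.pow_const 2).aestronglyMeasurable]
  exact (integrable_pow_four hX).congr (ae_of_all _ fun ω => by ring)

/-- The points `x i` may coincide, so the vector is obtained linearly from the law over the image of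
`x`. -/
lemma hasGaussianLaw_pi {T ι : Type*} [Fintype ι] {Y : T → Ω → ℝ} (hY : IsGaussianProcess Y P)
    (x : ι → T) : HasGaussianLaw (fun ω i => Y (x i) ω) P := by
  classical
  let Λ : (↥(Finset.univ.image x) → ℝ) →L[ℝ] (ι → ℝ) :=
    ContinuousLinearMap.pi fun i => ContinuousLinearMap.proj
      (⟨x i, Finset.mem_image_of_mem x (Finset.mem_univ i)⟩ : ↥(Finset.univ.image x))
  exact (hY.hasGaussianLaw (Finset.univ.image x)).map_fun Λ

/-- Mean and variance of a quadratic form in a centered Gaussian vector. -/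
lemma variance_quadForm_le [IsProbabilityMeasure P] {n : ℕ} {y : Ω → Fin n → ℝ}
    (hy : HasGaussianLaw y P) (h0 : ∀ i, ∫ ω, y ω i ∂P = 0) {A N : Matrix (Fin n) (Fin n) ℝ}
    (hcov : ∀ i j, covariance (fun ω => y ω i) (fun ω => y ω j) P = A i j)
    (hA : A.PosDef) (hN : N.IsHermitian) :
    MemLp (fun ω => y ω ⬝ᵥ N.mulVec (y ω)) 2 P ∧
    ∫ ω, y ω ⬝ᵥ N.mulVec (y ω) ∂P = (N * A).trace ∧
    variance (fun ω => y ω ⬝ᵥ N.mulVec (y ω)) P ≤ gaussFourth * (N * A * (N * A)).trace := by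
  obtain ⟨V, l, hV, hl⟩ := exists_simultaneous_diagonalization hA hN
  have hdet : IsUnit V.det := by
    have h1 : A.det ≠ 0 := hA.det_pos.ne'
    rw [← hV, Matrix.det_mul] at h1
    exact (left_ne_zero_of_mul h1).isUnit
  set W := V⁻¹ with hW
  have hWV : W * V = 1 := Matrix.nonsing_inv_mul _ hdet
  have hVW : V * W = 1 := Matrix.mul_nonsing_inv _ hdet
  -- Whitening: `z` has identity covariance and is jointly Gaussian, so its coordinates are
  -- independent and the form becomes `∑ l i * z i ^ 2`.
  let z : Fin n → Ω → ℝ := fun i ω => W.mulVec (y ω) i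
  have hzL : HasGaussianLaw (fun ω i => z i ω) P :=
    hy.map_fun (LinearMap.toContinuousLinearMap W.mulVecLin)
  have hyi : ∀ i, HasGaussianLaw (fun ω => y ω i) P := fun i => HasGaussianLaw.eval hy i
  have hz : ∀ i, HasGaussianLaw (z i) P := fun i => HasGaussianLaw.eval hzL i
  have hz0 : ∀ i, ∫ ω, z i ω ∂P = 0 := fun i => by
    simp only [z, Matrix.mulVec, dotProduct]
    rw [integral_finsetSum _ fun j _ => (hyi j).integrable.const_mul _]
    simp [integral_const_mul, h0]
  have hzcov : ∀ i j, covariance (z i) (z j) P = (1 : Matrix (Fin n) (Fin n) ℝ) i j := by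
    intro i j
    have e : (W * A * Wᵀ) = 1 := by
      rw [← hV, ← Matrix.mul_assoc, hWV, Matrix.one_mul, ← Matrix.transpose_mul, hWV,
        Matrix.transpose_one]
    rw [← e]
    simp only [z, Matrix.mulVec, dotProduct]
    rw [covariance_fun_sum_fun_sum (fun a => (hyi a).memLp_two.const_mul _)
      (fun a => (hyi a).memLp_two.const_mul _), Finset.sum_comm]
    simp only [covariance_const_mul_left, covariance_const_mul_right, hcov, Matrix.mul_apply,
      Finset.sum_mul, Matrix.transpose_apply]
    exact Finset.sum_congr rfl fun a _ => Finset.sum_congr rfl fun b _ => by ring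
  have hquad : ∀ ω, y ω ⬝ᵥ N.mulVec (y ω) = ∑ i, l i * z i ω ^ 2 := fun ω => by
    have e1 : y ω = V.mulVec (W.mulVec (y ω)) := by
      rw [Matrix.mulVec_mulVec, hVW, Matrix.one_mulVec]
    have e2 : y ω ⬝ᵥ N.mulVec (y ω)
        = W.mulVec (y ω) ⬝ᵥ (Vᵀ * N * V).mulVec (W.mulVec (y ω)) := by
      conv_lhs => rw [e1]
      rw [Matrix.mul_assoc, ← Matrix.mulVec_mulVec, Matrix.dotProduct_mulVec _ Vᵀ,
        Matrix.vecMul_transpose, ← Matrix.mulVec_mulVec]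
    rw [e2, hl]
    simp only [dotProduct, Matrix.mulVec_diagonal, z]
    exact Finset.sum_congr rfl fun i _ => by ring
  have hsq : ∀ i, MemLp (fun ω => l i * z i ω ^ 2) 2 P := fun i => (memLp_sq (hz i)).const_mul _
  have hone : ∀ i, ∫ ω, z i ω ^ 2 ∂P = 1 := fun i => by
    have h1 := hzcov i i
    rw [covariance_self (hz i).aemeasurable, variance_of_integral_eq_zero (hz i).aemeasurable
      (hz0 i)] at h1
    simpa using h1
  have htr : (N * A).trace = ∑ i, l i := by
    rw [← hV, ← Matrix.mul_assoc, Matrix.trace_mul_comm, ← Matrix.mul_assoc, hl,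
      Matrix.trace_diagonal]
  have htr2 : (N * A * (N * A)).trace = ∑ i, l i ^ 2 := by
    calc (N * A * (N * A)).trace = (N * V * (Vᵀ * N * V) * Vᵀ).trace := by
          rw [← hV]; simp only [Matrix.mul_assoc]
      _ = (Vᵀ * N * V * (Vᵀ * N * V)).trace := by
          rw [Matrix.trace_mul_comm]; simp only [Matrix.mul_assoc]
      _ = _ := by
          rw [hl, Matrix.diagonal_mul_diagonal, Matrix.trace_diagonal]
          exact Finset.sum_congr rfl fun i _ => by ring
  have hfun : (fun ω => y ω ⬝ᵥ N.mulVec (y ω)) = ∑ i, fun ω => l i * z i ω ^ 2 := by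
    ext ω; rw [hquad, Finset.sum_apply]
  refine ⟨?_, ?_, ?_⟩
  · rw [hfun]; exact memLp_finsetSum' _ fun i _ => hsq i
  · simp only [hquad]
    rw [integral_finsetSum _ fun i _ => (hsq i).integrable (by norm_num), htr]
    simp [integral_const_mul, hone]
  · rw [hfun, IndepFun.variance_sum (fun i _ => hsq i), htr2, Finset.mul_sum]
    · refine Finset.sum_le_sum fun i _ => ?_
      rw [variance_const_mul, mul_comm]
      refine mul_le_mul_of_nonneg_right ?_ (sq_nonneg _)
      -- Bounding the variance of `z i ^ 2` by its second moment loses only a constant.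
      refine (variance_le_expectation_sq (memLp_sq (hz i)).aestronglyMeasurable).trans
        (le_of_eq ?_)
      have := integral_pow_four (hz i) (hz0 i) (hzcov i i)
      rw [Matrix.one_apply_eq, one_pow, one_mul] at this
      rw [← this]
      exact integral_congr_ae (ae_of_all _ fun ω => by simp; ring)
    · intro i _ j _ hij
      have hpair : HasGaussianLaw (fun ω => (z i ω, z j ω)) P := HasGaussianLaw.prodMk hzL i j
      have hind : IndepFun (z i) (z j) P := hpair.indepFun_of_covariance_eq_zero (by
        rw [hzcov, Matrix.one_apply_ne hij])
      exact hind.comp (φ := fun x => l i * x ^ 2) (ψ := fun x => l j * x ^ 2)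
        (by fun_prop) (by fun_prop)

end Gaussian

namespace WellConditioned

variable {c S : ℝ} {n : ℕ} {R R₀ : Matrix (Fin n) (Fin n) ℝ}

/-- Row sums of `R⁻¹ R₀` are bounded independently of `n`, so each diagonal entry of its square is
too; hence the variance of the likelihood form is `O(n)`. -/
lemma trace_sq_inv_mul_le (hc : 0 < c) (hS : 0 ≤ S) (h : WellConditioned c S R)
    (h₀ : WellConditioned c S R₀) :
    (R⁻¹ * R₀ * (R⁻¹ * R₀)).trace ≤ n * (invBound c S * S) ^ 2 := by
  set X := R⁻¹ * R₀ with hX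
  have hB : 0 ≤ invBound c S := mul_nonneg (by positivity) (Real.sqrt_nonneg _)
  have hrow : ∀ i, ∑ j, |X i j| ≤ invBound c S * S := fun i => by
    calc ∑ j, |X i j| ≤ ∑ j, ∑ k, |R⁻¹ i k| * |R₀ k j| := by
          refine Finset.sum_le_sum fun j _ => ?_
          rw [hX, Matrix.mul_apply]
          refine (Finset.abs_sum_le_sum_abs _ _).trans (le_of_eq ?_)
          simp only [abs_mul]
      _ = ∑ k, |R⁻¹ i k| * ∑ j, |R₀ k j| := by
          rw [Finset.sum_comm]; simp only [Finset.mul_sum]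
      _ ≤ ∑ k, |R⁻¹ i k| * S :=
          Finset.sum_le_sum fun k _ => mul_le_mul_of_nonneg_left (h₀.row k) (abs_nonneg _)
      _ ≤ _ := by
          rw [← Finset.sum_mul]
          exact mul_le_mul_of_nonneg_right (h.inv_row hc hS i) hS
  have hent : ∀ i j, |X i j| ≤ invBound c S * S := fun i j =>
    (Finset.single_le_sum (f := fun j => |X i j|) (fun _ _ => abs_nonneg _)
      (Finset.mem_univ j)).trans (hrow i)
  have hterm : ∀ i, (X * X).diag i ≤ (invBound c S * S) ^ 2 := fun i => by
    rw [Matrix.diag_apply, Matrix.mul_apply]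
    refine (le_abs_self _).trans ((Finset.abs_sum_le_sum_abs _ _).trans ?_)
    calc ∑ j, |X i j * X j i| ≤ ∑ j, |X i j| * (invBound c S * S) := by
          refine Finset.sum_le_sum fun j _ => ?_
          rw [abs_mul]
          exact mul_le_mul_of_nonneg_left (hent j i) (abs_nonneg _)
      _ ≤ _ := by
          rw [← Finset.sum_mul, sq]
          exact mul_le_mul_of_nonneg_right (hrow i) (by positivity)
  refine (Finset.sum_le_sum fun i _ => hterm i).trans (le_of_eq ?_)
  simp

end WellConditioned

/-! ### Finite nets for monotone functions, uniformly in the number of points. -/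

lemma abs_sub_le_of_floor_eq {x y δ : ℝ} (hδ : 0 < δ) (hx : 0 ≤ x) (hy : 0 ≤ y)
    (h : ⌊x / δ⌋₊ = ⌊y / δ⌋₊) : |x - y| ≤ δ := by
  have h1 := Nat.floor_le (div_nonneg hx hδ.le)
  have h2 := Nat.lt_floor_add_one (x / δ)
  have h3 := Nat.floor_le (div_nonneg hy hδ.le)
  have h4 := Nat.lt_floor_add_one (y / δ)
  rw [h] at h1 h2
  rw [le_div_iff₀ hδ] at h1 h3
  rw [div_lt_iff₀ hδ] at h2 h4
  rw [abs_le]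
  constructor <;> nlinarith

/-- Between two nodes where they nearly agree, monotone functions differ by at most the drop of `g`
across the block plus a multiple of `δ`; the drops telescope. -/
lemma sum_abs_sub_le_of_antitone {g g' : ℕ → ℝ} (hg : Antitone g) (hg' : Antitone g') {δ : ℝ}
    {s K : ℕ} (h : ∀ j ≤ K, |g (j * s) - g' (j * s)| ≤ δ) :
    ∑ i ∈ Finset.range (K * s), |g i - g' i| ≤ s * (g 0 - g (K * s) + 3 * δ * K) := by
  induction K with
  | zero => simp
  | succ K ih =>
    rw [Nat.succ_mul, Finset.sum_range_add]
    have h1 := ih fun j hj => h j (hj.trans K.le_succ)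
    have hK := abs_le.1 (h K K.le_succ)
    have hK' := abs_le.1 (h (K + 1) le_rfl)
    rw [Nat.succ_mul] at hK'
    have h2 : ∑ r ∈ Finset.range s, |g (K * s + r) - g' (K * s + r)|
        ≤ ∑ _r ∈ Finset.range s, (g (K * s) - g (K * s + s) + 3 * δ) := by
      refine Finset.sum_le_sum fun r hr => ?_
      have hr' := (Finset.mem_range.1 hr).le
      have a1 := hg (Nat.le_add_right (K * s) r)
      have a2 := hg (Nat.add_le_add_left hr' (K * s))
      have b1 := hg' (Nat.le_add_right (K * s) r)
      have b2 := hg' (Nat.add_le_add_left hr' (K * s))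
      rw [abs_le]
      constructor <;> linarith
    rw [Finset.sum_const, Finset.card_range, nsmul_eq_mul] at h2
    push_cast
    nlinarith

/-- Monotone functions are totally bounded in mean, uniformly in the number of points. -/
lemma exists_code_antitone (A : ℝ) {ε : ℝ} (hε : 0 < ε) : ∃ K M : ℕ, ∀ (m : ℕ), K ≤ m →
    ∀ {ι : Type} (f : ι → Fin m → ℝ), (∀ a, Antitone (f a)) → (∀ a i, |f a i| ≤ A) →
    ∃ code : ι → Fin (K + 1) → Fin M, ∀ a b, code a = code b → ∑ i, |f a i - f b i| ≤ ε * m := by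
  obtain ⟨K, hK⟩ := exists_nat_gt (8 * |A| / ε)
  have hK0 : (0 : ℝ) < K := lt_of_le_of_lt (by positivity) hK
  have hKpos : 0 < K := by exact_mod_cast hK0
  rw [div_lt_iff₀ hε] at hK
  set δ := ε / 12 with hδ
  have hδ0 : 0 < δ := by positivity
  refine ⟨K, ⌊2 * A / δ⌋₊ + 1, fun m hm ι f hf hA => ?_⟩
  have hm0 : 0 < m := hKpos.trans_le hm
  -- The code records values at the nodes `j * s`, rounded to precision `δ`. Since `K * s` may
  -- exceed `m`, functions are extended by their last value.
  set s := m / K + 1 with hs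
  let g : ι → ℕ → ℝ := fun a i => f a ⟨min i (m - 1), by omega⟩
  have hg : ∀ a, Antitone (g a) := fun a i j hij => hf a (by
    rw [Fin.mk_le_mk]; exact min_le_min_right _ hij)
  have hgA : ∀ a i, |g a i| ≤ A := fun a i => hA a _
  have hgf : ∀ a (i : Fin m), g a i = f a i := fun a i => by
    simp only [g]; congr 1; ext; simp; omega
  refine ⟨fun a j => ⟨⌊(g a (j * s) + A) / δ⌋₊, Nat.lt_succ_of_le (Nat.floor_le_floor ?_)⟩,
    fun a b hab => ?_⟩
  · have := abs_le.1 (hgA a (j * s))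
    gcongr
    linarith
  have hclose : ∀ j ≤ K, |g a (j * s) - g b (j * s)| ≤ δ := fun j hj => by
    have h1 := congrFun hab ⟨j, Nat.lt_succ_of_le hj⟩
    rw [Fin.mk.injEq] at h1
    have h2 := abs_le.1 (hgA a (j * s))
    have h3 := abs_le.1 (hgA b (j * s))
    have := abs_sub_le_of_floor_eq hδ0 (by linarith) (by linarith) h1
    simpa using this
  have hmKs : m ≤ K * s := by
    have h1 := Nat.div_add_mod m K
    have h2 := Nat.mod_lt m hKpos
    rw [hs, Nat.mul_add, mul_one]
    omega
  have hsm : (s : ℝ) * K ≤ 2 * m := by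
    have h1 : m / K * K ≤ m := Nat.div_mul_le_self m K
    have : s * K ≤ 2 * m := by rw [hs, Nat.add_mul, one_mul]; omega
    exact_mod_cast this
  calc ∑ i, |f a i - f b i| = ∑ i ∈ Finset.range m, |g a i - g b i| := by
        rw [Finset.sum_range]; simp only [hgf]
    _ ≤ ∑ i ∈ Finset.range (K * s), |g a i - g b i| :=
        Finset.sum_le_sum_of_subset_of_nonneg (Finset.range_subset_range.2 hmKs)
          fun _ _ _ => abs_nonneg _
    _ ≤ s * (g a 0 - g a (K * s) + 3 * δ * K) :=
        sum_abs_sub_le_of_antitone (hg a) (hg b) hclose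
    _ ≤ s * (2 * |A| + 3 * δ * K) := by
        have h1 := abs_le.1 (hgA a 0)
        have h2 := abs_le.1 (hgA a (K * s))
        have h3 := le_abs_self A
        exact mul_le_mul_of_nonneg_left (by linarith) (Nat.cast_nonneg s)
    _ ≤ s * (ε / 2 * K) := by
        refine mul_le_mul_of_nonneg_left ?_ (Nat.cast_nonneg s)
        rw [hδ]; linarith
    _ ≤ ε * m := by nlinarith

/-- A code for monotone functions evaluated at finitely many points. -/
lemma exists_code_antitoneOn (A : ℝ) {ε : ℝ} (hε : 0 < ε) : ∃ K M : ℕ, ∀ {κ : Type}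
    (T : Finset κ), K ≤ T.card → ∀ (d : κ → ℝ), (∀ k, 0 ≤ d k) → ∀ {ι : Type} (f : ι → ℝ → ℝ),
    (∀ a, AntitoneOn (f a) (Set.Ici 0)) → (∀ a t, 0 ≤ t → |f a t| ≤ A) →
    ∃ code : ι → Fin (K + 1) → Fin M, ∀ a b, code a = code b →
      ∑ k ∈ T, |f a (d k) - f b (d k)| ≤ ε * T.card := by
  obtain ⟨K, M, h⟩ := exists_code_antitone A hε
  refine ⟨K, M, fun {κ} T hT d hd {ι} f hf hA => ?_⟩
  let e := T.equivFin.symm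
  let u : Fin T.card → ℝ := fun i => d (e i)
  -- Sorting the sample points makes every `f a` antitone in the index, and the sum does not see the
  -- permutation.
  obtain ⟨code, hcode⟩ := h T.card hT (fun a i => f a (u (Tuple.sort u i)))
    (fun a i j hij => hf a (hd _) (hd _) (Tuple.monotone_sort u hij)) (fun a i => hA a _ (hd _))
  refine ⟨code, fun a b hab => le_trans (le_of_eq ?_) (hcode a b hab)⟩
  rw [Equiv.sum_comp (Tuple.sort u) (fun i => |f a (u i) - f b (u i)|), ← Finset.sum_coe_sort T]
  exact (e.sum_comp (fun k : T => |f a (d k) - f b (d k)|)).symm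

lemma card_band_le (n B : ℕ) :
    ((Finset.univ.filter fun q : Fin n × Fin n => Nat.dist q.1 q.2 ≤ B).card : ℝ)
      ≤ 2 * (B + 1) * n := by
  have hsum : ∀ k ∉ Finset.range (B + 1), (if k ≤ B then (1 : ℝ) else 0) = 0 := fun k hk => by
    rw [Finset.mem_range] at hk
    rw [if_neg (by omega)]
  have hs : Summable fun k : ℕ => if k ≤ B then (1 : ℝ) else 0 := summable_of_ne_finset_zero hsum
  have ht : ∑' k : ℕ, (if k ≤ B then (1 : ℝ) else 0) = B + 1 := by
    rw [tsum_eq_sum hsum, Finset.sum_congr rfl fun k hk => if_pos (Finset.mem_range_succ_iff.1 hk)]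
    simp
  rw [Finset.card_filter, Nat.cast_sum, Fintype.sum_prod_type]
  have : ∀ i : Fin n, ∑ j : Fin n, (((if Nat.dist i j ≤ B then 1 else 0 : ℕ)) : ℝ)
      ≤ 2 * (B + 1) := fun i => by
    have := sum_fin_dist_le (g := fun k : ℕ => if k ≤ B then (1 : ℝ) else 0)
      (fun k => by split_ifs <;> norm_num) hs i
    rw [ht] at this
    simpa using this
  refine (Finset.sum_le_sum fun i _ => this i).trans (le_of_eq ?_)
  simp; ring

lemma le_card_band (n B : ℕ) :
    n ≤ (Finset.univ.filter fun q : Fin n × Fin n => Nat.dist q.1 q.2 ≤ B).card := by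
  have h1 : (Finset.univ.image fun i : Fin n => (i, i)) ⊆
      Finset.univ.filter fun q : Fin n × Fin n => Nat.dist q.1 q.2 ≤ B := fun q hq => by
    obtain ⟨i, -, rfl⟩ := Finset.mem_image.1 hq
    simp [Nat.dist_self]
  have h2 := Finset.card_le_card h1
  rwa [Finset.card_image_of_injective _ fun i j h => (Prod.mk.inj h).1, Finset.card_univ,
    Fintype.card_fin] at h2

/-- Matrices of monotone functions of the distance, with summable rows, are totally bounded in
mean uniformly in the size. -/
lemma exists_finite_net (A S : ℝ) {ε : ℝ} (hε : 0 < ε) : ∃ N n₀ : ℕ, ∀ n, n₀ ≤ n →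
    ∀ (d : Fin n → Fin n → ℝ), (∀ i j, 0 ≤ d i j) → ∀ {ι : Type} (f : ι → ℝ → ℝ),
    (∀ a, AntitoneOn (f a) (Set.Ici 0)) → (∀ a t, 0 ≤ t → |f a t| ≤ A) →
    (∀ a i, ∑ j, |f a (d i j)| * (1 + |(i : ℝ) - j|) ≤ S) →
    ∃ G : Finset ι, G.card ≤ N ∧ ∀ a, ∃ b ∈ G,
      ∑ i, ∑ j, |f a (d i j) - f b (d i j)| ≤ ε * n := by
  classical
  -- Outside a band of width `B` the weighted row bound leaves at most `ε / 4` per row and per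
  -- function. Inside there are at most `2 * (B + 1) * n` pairs, so precision `ε / (4 * (B + 1))`
  -- costs `ε / 2 * n`.
  obtain ⟨B, hB⟩ := exists_nat_gt (4 * |S| / ε)
  rw [div_lt_iff₀ hε] at hB
  obtain ⟨K, M, hKM⟩ := exists_code_antitoneOn A (ε := ε / (4 * (B + 1))) (by positivity)
  refine ⟨Fintype.card (Fin (K + 1) → Fin M), K, fun n hn d hd ι f hf hA hS => ?_⟩
  rcases isEmpty_or_nonempty ι with hι | hι
  · exact ⟨∅, by simp, fun a => (hι.false a).elim⟩
  set T := Finset.univ.filter fun q : Fin n × Fin n => Nat.dist q.1 q.2 ≤ B with hT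
  obtain ⟨code, hcode⟩ := hKM T (hn.trans (le_card_band n B)) (fun q => d q.1 q.2)
    (fun q => hd _ _) f hf hA
  choose! rep hrep using fun (z : Fin (K + 1) → Fin M) (h : ∃ a, code a = z) => h
  refine ⟨(Finset.univ.filter fun z => ∃ a, code a = z).image rep,
    Finset.card_image_le.trans (Finset.card_le_univ _), fun a => ⟨rep (code a),
      Finset.mem_image_of_mem _ (by simp), ?_⟩⟩
  set b := rep (code a) with hb
  have hab : code a = code b := (hrep (code a) ⟨a, rfl⟩).symm
  have h1 := hcode a b hab
  have h2 : ε / (4 * (B + 1)) * (T.card : ℝ) ≤ ε / 2 * n := by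
    have := card_band_le n B
    rw [← hT] at this
    refine (mul_le_mul_of_nonneg_left this (by positivity)).trans (le_of_eq ?_)
    field_simp
    ring
  have hfar : ∀ (c : ι) (i : Fin n), ∑ j : Fin n, (if Nat.dist i j ≤ B then 0 else |f c (d i j)|) ≤ ε / 4 := fun c i => by
    have h3 : (∑ j : Fin n, (if Nat.dist i j ≤ B then 0 else |f c (d i j)|)) * (1 + B) ≤ S := by
      rw [Finset.sum_mul]
      refine (Finset.sum_le_sum fun j _ => ?_).trans (hS c i)
      split_ifs with h
      · simp only [zero_mul]; positivity
      · refine mul_le_mul_of_nonneg_left ?_ (abs_nonneg _)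
        rw [← natDist_cast]
        have : (B : ℝ) ≤ Nat.dist i j := by exact_mod_cast (not_le.1 h).le
        linarith
    have h4 := le_abs_self S
    have h5 : (0 : ℝ) < 1 + B := by positivity
    refine le_of_mul_le_mul_right ?_ h5
    nlinarith
  have hsplit : ∑ i, ∑ j, |f a (d i j) - f b (d i j)|
      ≤ ∑ q ∈ T, |f a (d q.1 q.2) - f b (d q.1 q.2)|
        + (∑ i : Fin n, (ε / 4 + ε / 4)) := by
    rw [hT, Finset.sum_filter, Fintype.sum_prod_type, ← Finset.sum_add_distrib]
    refine Finset.sum_le_sum fun i _ => ?_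
    refine le_trans ?_ (add_le_add_right (add_le_add (hfar a i) (hfar b i)) _)
    rw [← Finset.sum_add_distrib, ← Finset.sum_add_distrib]
    refine Finset.sum_le_sum fun j _ => ?_
    split_ifs
    · simp
    · simpa using abs_sub (f a (d i j)) (f b (d i j))
  refine hsplit.trans ?_
  simp only [Finset.sum_const, Finset.card_univ, Fintype.card_fin, nsmul_eq_mul]
  linarith

/-! ### Uniform law of large numbers and consistency. -/

section Fluctuations

variable {Ω : Type*} [MeasurableSpace Ω] {P : Measure Ω}

/-- The deviation of the quadratic form of the likelihood from its mean. -/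
def fluct {n : ℕ} (R R₀ : Matrix (Fin n) (Fin n) ℝ) (y : Fin n → ℝ) : ℝ :=
  y ⬝ᵥ R⁻¹.mulVec y - (R⁻¹ * R₀).trace

lemma measureReal_fluct_ge_le [IsProbabilityMeasure P] {c S : ℝ} (hc : 0 < c) (hS : 0 ≤ S) {n : ℕ} (hn : 0 < n)
    {R R₀ : Matrix (Fin n) (Fin n) ℝ} (h : WellConditioned c S R) (h₀ : WellConditioned c S R₀)
    {y : Ω → Fin n → ℝ} (hy : HasGaussianLaw y P) (h0 : ∀ i, ∫ ω, y ω i ∂P = 0)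
    (hcov : ∀ i j, covariance (fun ω => y ω i) (fun ω => y ω j) P = R₀ i j)
    {η : ℝ} (hη : 0 < η) :
    P.real {ω | η * n ≤ |fluct R R₀ (y ω)|}
      ≤ gaussFourth * (invBound c S * S) ^ 2 / η ^ 2 / n := by
  obtain ⟨h1, h2, h3⟩ := variance_quadForm_le hy h0 hcov (h₀.posDef hc) h.inv_symm
  have hn' : (0 : ℝ) < n := by exact_mod_cast hn
  have h4 := meas_ge_le_variance_div_sq h1 (c := η * n) (by positivity)
  rw [h2] at h4
  have hv := variance_nonneg (fun ω => y ω ⬝ᵥ R⁻¹.mulVec (y ω)) P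
  refine (ENNReal.toReal_le_of_le_ofReal (by positivity) h4).trans ?_
  have h5 := h3.trans (mul_le_mul_of_nonneg_left (h.trace_sq_inv_mul_le hc hS h₀)
    gaussFourth_nonneg)
  calc variance (fun ω => y ω ⬝ᵥ R⁻¹.mulVec (y ω)) P / (η * n) ^ 2
      ≤ gaussFourth * (n * (invBound c S * S) ^ 2) / (η * n) ^ 2 := by gcongr
    _ = _ := by field_simp

lemma measureReal_sum_pow_four_ge_le {c S : ℝ} {n : ℕ} (hn : 0 < n)
    {R₀ : Matrix (Fin n) (Fin n) ℝ} (h₀ : WellConditioned c S R₀)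
    {y : Ω → Fin n → ℝ} (hy : HasGaussianLaw y P) (h0 : ∀ i, ∫ ω, y ω i ∂P = 0)
    (hcov : ∀ i j, covariance (fun ω => y ω i) (fun ω => y ω j) P = R₀ i j)
    {η : ℝ} (hη : 0 < η) :
    P.real {ω | η * n ≤ ∑ i, y ω i ^ 4} ≤ S ^ 2 * gaussFourth / η := by
  have hyi : ∀ i, HasGaussianLaw (fun ω => y ω i) P := fun i => HasGaussianLaw.eval hy i
  have hn' : (0 : ℝ) < n := by exact_mod_cast hn
  have h1 := mul_meas_ge_le_integral_of_nonneg (μ := P) (f := fun ω => ∑ i, y ω i ^ 4)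
    (ae_of_all _ fun ω => Finset.sum_nonneg fun i _ => by positivity)
    (integrable_finsetSum _ fun i _ => integrable_pow_four (hyi i)) (η * n)
  have h2 : ∫ ω, ∑ i, y ω i ^ 4 ∂P ≤ n * (S ^ 2 * gaussFourth) := by
    rw [integral_finsetSum _ fun i _ => integrable_pow_four (hyi i)]
    refine (Finset.sum_le_sum (g := fun _ => S ^ 2 * gaussFourth) fun i _ => ?_).trans
      (le_of_eq (by simp))
    rw [integral_pow_four (hyi i) (h0 i) (hcov i i)]
    refine mul_le_mul_of_nonneg_right ?_ gaussFourth_nonneg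
    refine sq_le_sq' ?_ ?_
    all_goals
      have h3 := (Finset.single_le_sum (f := fun j => |R₀ i j|) (fun _ _ => abs_nonneg _)
        (Finset.mem_univ i)).trans (h₀.row i)
      have := abs_le.1 h3
      linarith
  rw [le_div_iff₀ hη]
  have h3 := h1.trans h2
  refine le_of_mul_le_mul_right ?_ hn'
  nlinarith

end Fluctuations

section Consistency

variable {Ω : Type*} [MeasurableSpace Ω] {P : Measure Ω} [IsProbabilityMeasure P]

/-- A uniform law of large numbers for the quadratic forms of the likelihood. -/
lemma tendsto_measureReal_exists_fluct {c S : ℝ} (hc : 0 < c) (hS : 0 ≤ S)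
    {y : ∀ n, Ω → Fin n → ℝ} (hy : ∀ n, HasGaussianLaw (y n) P)
    (h0 : ∀ n i, ∫ ω, y n ω i ∂P = 0) {R₀ : ∀ n, Matrix (Fin n) (Fin n) ℝ}
    (hcov : ∀ n i j, covariance (fun ω => y n ω i) (fun ω => y n ω j) P = R₀ n i j)
    (hR₀ : ∀ n, WellConditioned c S (R₀ n)) {ι : Type} {R : ∀ n, ι → Matrix (Fin n) (Fin n) ℝ}
    (hR : ∀ n a, WellConditioned c S (R n a))
    (hnet : ∀ ε : ℝ, 0 < ε → ∃ N n₀ : ℕ, ∀ n, n₀ ≤ n → ∃ G : Finset ι, G.card ≤ N ∧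
      ∀ a, ∃ b ∈ G, ∑ i, ∑ j, |R n a i j - R n b i j| ≤ ε * n)
    {η : ℝ} (hη : 0 < η) :
    Tendsto (fun n : ℕ => P.real {ω | ∃ a, η * n ≤ |fluct (R n a) (R₀ n) (y n ω)|})
      atTop (𝓝 0) := by
  rw [Metric.tendsto_atTop]
  intro ρ hρ
  set T : ℝ := (S ^ 2 * gaussFourth + 1) * 2 / ρ with hT
  have hm4 := gaussFourth_nonneg
  have hT0 : 0 < T := by positivity
  set b := invBound c S with hb
  obtain ⟨ε, hε, hφ⟩ : ∃ ε : ℝ, 0 < ε ∧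
      b ^ 2 * Real.sqrt T * Real.sqrt (2 * S * ε) + b ^ 2 * S * ε ≤ η / 2 := by
    have hcont : Continuous fun ε : ℝ =>
        b ^ 2 * Real.sqrt T * Real.sqrt (2 * S * ε) + b ^ 2 * S * ε := by fun_prop
    have h1 : ∀ᶠ ε in 𝓝 (0 : ℝ),
        b ^ 2 * Real.sqrt T * Real.sqrt (2 * S * ε) + b ^ 2 * S * ε < η / 2 :=
      hcont.continuousAt.eventually_lt_const (by simpa using by positivity)
    obtain ⟨ε, h2, h3⟩ := ((h1.filter_mono nhdsWithin_le_nhds).and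
      (self_mem_nhdsWithin (s := Set.Ioi (0 : ℝ)))).exists
    exact ⟨ε, h3, h2.le⟩
  obtain ⟨N, n₀, hN⟩ := hnet ε hε
  set C := gaussFourth * (b * S) ^ 2 / (η / 2) ^ 2 with hC
  have hC0 : 0 ≤ C := by positivity
  obtain ⟨n₁, hn₁⟩ := exists_nat_gt (2 * (N * C) / ρ)
  refine ⟨max (max n₀ n₁) 1, fun n hn => ?_⟩
  have hnn₀ : n₀ ≤ n := (le_max_left _ _).trans ((le_max_left _ _).trans hn)
  have hnn₁ : n₁ ≤ n := (le_max_right _ _).trans ((le_max_left _ _).trans hn)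
  have hn0 : 0 < n := (le_max_right _ _).trans hn
  have hn' : (0 : ℝ) < n := by exact_mod_cast hn0
  obtain ⟨G, hG, hcov'⟩ := hN n hnn₀
  -- Off the event of a large fourth-power sum, a large fluctuation anywhere forces one of at least
  -- half the size in the net; the union bound over `N` net points is then `O(1 / n)`.
  have hsub : {ω | ∃ a, η * n ≤ |fluct (R n a) (R₀ n) (y n ω)|} ⊆
      {ω | T * n ≤ ∑ i, y n ω i ^ 4} ∪
        ⋃ g ∈ G, {ω | η / 2 * n ≤ |fluct (R n g) (R₀ n) (y n ω)|} := by
    rintro ω ⟨a, ha⟩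
    by_cases hω : T * n ≤ ∑ i, y n ω i ^ 4
    · exact Or.inl hω
    right
    push Not at hω
    obtain ⟨g, hgG, hg⟩ := hcov' a
    refine Set.mem_biUnion hgG ?_
    have h1 := (hR n a).abs_quadForm_inv_sub_le hc hS (hR n g) (y n ω)
    have h2 := (hR n a).abs_trace_inv_sub_mul_le hc hS (hR n g) (hR₀ n)
    have h3 : Real.sqrt (∑ i, y n ω i ^ 4) ≤ Real.sqrt T * Real.sqrt n := by
      rw [← Real.sqrt_mul hT0.le]; exact Real.sqrt_le_sqrt hω.le
    have h4 : Real.sqrt (2 * S * ∑ i, ∑ j, |R n a i j - R n g i j|)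
        ≤ Real.sqrt (2 * S * ε) * Real.sqrt n := by
      rw [← Real.sqrt_mul (by positivity)]
      refine Real.sqrt_le_sqrt ?_
      have := mul_le_mul_of_nonneg_left hg (by positivity : 0 ≤ 2 * S)
      linarith
    have h5 : b ^ 2 * Real.sqrt (∑ i, y n ω i ^ 4)
        * Real.sqrt (2 * S * ∑ i, ∑ j, |R n a i j - R n g i j|)
        ≤ b ^ 2 * (Real.sqrt T * Real.sqrt n) * (Real.sqrt (2 * S * ε) * Real.sqrt n) := by
      gcongr
    have h6 : b ^ 2 * S * ∑ i, ∑ j, |R n a i j - R n g i j| ≤ b ^ 2 * S * (ε * n) := by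
      gcongr
    have h7 : b ^ 2 * (Real.sqrt T * Real.sqrt n) * (Real.sqrt (2 * S * ε) * Real.sqrt n)
        = b ^ 2 * Real.sqrt T * Real.sqrt (2 * S * ε) * n := by
      have := Real.mul_self_sqrt hn'.le
      linear_combination (b ^ 2 * Real.sqrt T * Real.sqrt (2 * S * ε)) * this
    have h8 : |fluct (R n a) (R₀ n) (y n ω) - fluct (R n g) (R₀ n) (y n ω)| ≤ η / 2 * n := by
      have e : fluct (R n a) (R₀ n) (y n ω) - fluct (R n g) (R₀ n) (y n ω)
          = (y n ω ⬝ᵥ (R n a)⁻¹.mulVec (y n ω) - y n ω ⬝ᵥ (R n g)⁻¹.mulVec (y n ω))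
            - (((R n a)⁻¹ * R₀ n).trace - ((R n g)⁻¹ * R₀ n).trace) := by
        simp only [fluct]; ring
      rw [e]
      refine (abs_sub _ _).trans ?_
      have := mul_le_mul_of_nonneg_right hφ hn'.le
      linarith
    have h9 := abs_sub_abs_le_abs_sub (fluct (R n a) (R₀ n) (y n ω)) (fluct (R n g) (R₀ n) (y n ω))
    change η / 2 * n ≤ |fluct (R n g) (R₀ n) (y n ω)|
    linarith
  have hbound : P.real {ω | ∃ a, η * n ≤ |fluct (R n a) (R₀ n) (y n ω)|}
      ≤ S ^ 2 * gaussFourth / T + N * (C / n) := by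
    refine (measureReal_mono hsub).trans ((measureReal_union_le _ _).trans (add_le_add
      (measureReal_sum_pow_four_ge_le hn0 (hR₀ n) (hy n) (h0 n) (hcov n) hT0) ?_))
    refine (measureReal_biUnion_finset_le _ _).trans ?_
    refine (Finset.sum_le_sum fun g _ => measureReal_fluct_ge_le hc hS hn0 (hR n g) (hR₀ n)
      (hy n) (h0 n) (hcov n) (half_pos hη)).trans ?_
    rw [Finset.sum_const, nsmul_eq_mul]
    refine mul_le_mul_of_nonneg_right (by exact_mod_cast hG) (by positivity)
  have h1 : S ^ 2 * gaussFourth / T < ρ / 2 := by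
    rw [div_lt_iff₀ hT0, hT]
    field_simp
    linarith
  have h2 : N * (C / n) < ρ / 2 := by
    have : (n₁ : ℝ) ≤ n := by exact_mod_cast hnn₁
    rw [div_lt_iff₀ hρ] at hn₁
    rw [← mul_div_assoc, div_lt_iff₀ hn']
    nlinarith
  rw [Real.dist_eq, sub_zero, abs_of_nonneg measureReal_nonneg]
  linarith

/-- Parameters whose covariance matrices are far from the true one have a larger criterion. -/
lemma tendsto_measureReal_exists_criterion_le {c S : ℝ} (hc : 0 < c) (hS : 0 < S)
    {y : ∀ n, Ω → Fin n → ℝ} (hy : ∀ n, HasGaussianLaw (y n) P)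
    (h0 : ∀ n i, ∫ ω, y n ω i ∂P = 0) {ι : Type} {R : ∀ n, ι → Matrix (Fin n) (Fin n) ℝ} (a₀ : ι)
    (hcov : ∀ n i j, covariance (fun ω => y n ω i) (fun ω => y n ω j) P = R n a₀ i j)
    (hR : ∀ n a, WellConditioned c S (R n a))
    (hnet : ∀ ε : ℝ, 0 < ε → ∃ N n₀ : ℕ, ∀ n, n₀ ≤ n → ∃ G : Finset ι, G.card ≤ N ∧
      ∀ a, ∃ b ∈ G, ∑ i, ∑ j, |R n a i j - R n b i j| ≤ ε * n)
    {κ : ℝ} (hκ : 0 < κ) :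
    Tendsto (fun n : ℕ => P.real {ω | ∃ a, κ * n ≤ ∑ i, ∑ j, (R n a i j - R n a₀ i j) ^ 2 ∧
      Real.log (R n a).det + y n ω ⬝ᵥ (R n a)⁻¹.mulVec (y n ω)
        ≤ Real.log (R n a₀).det + y n ω ⬝ᵥ (R n a₀)⁻¹.mulVec (y n ω)}) atTop (𝓝 0) := by
  have hk : 0 < klConst c S := by unfold klConst; positivity
  refine squeeze_zero (fun n => measureReal_nonneg) (fun n => measureReal_mono ?_)
    (tendsto_measureReal_exists_fluct hc hS.le hy h0 hcov (fun n => hR n a₀) hR hnet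
      (η := klConst c S * κ / 2) (by positivity))
  rintro ω ⟨a, h1, h2⟩
  have h3 := (hR n a).klConst_mul_le hc hS (hR n a₀)
  have h4 : ((R n a₀)⁻¹ * R n a₀).trace = n := by
    rw [Matrix.nonsing_inv_mul _
      ((Matrix.isUnit_iff_isUnit_det _).1 ((hR n a₀).posDef hc).isUnit), Matrix.trace_one,
      Fintype.card_fin]
  -- If `a` beats `a₀`, the divergence must be paid for by the fluctuations at `a₀` and `a`, one of
  -- which reaches half of it.
  have h5 : klConst c S * κ * n ≤ fluct (R n a₀) (R n a₀) (y n ω)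
      - fluct (R n a) (R n a₀) (y n ω) := by
    have := mul_le_mul_of_nonneg_left h1 hk.le
    simp only [fluct, h4]
    linarith
  by_contra hcon
  simp only [Set.mem_ofPred_eq, not_exists, not_le] at hcon
  have h6 := abs_lt.1 (hcon a₀)
  have h7 := abs_lt.1 (hcon a)
  linarith

end Consistency

/-! ### Stability of the kriging weights. -/

section Prediction

/-- The constant in the stability estimate for kriging weights. -/
def weightConst (c S ρ : ℝ) : ℝ := (1 + S / c) / c * (ρ + 2 * S * ((ρ + S * (ρ / c)) / c))

/-- Kriging weights depend continuously on the covariance, in a weighted norm. -/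
lemma l2_weight_inv_mulVec_sub_le {c S ρ ε : ℝ} (hc : 0 < c) (hS : 0 ≤ S) (hε : 0 ≤ ε)
    {n : ℕ} {R R₀ : Matrix (Fin n) (Fin n) ℝ} (h : WellConditioned c S R)
    (h₀ : WellConditioned c S R₀) {d : Fin n → ℝ} (hd1 : ∀ i, 1 ≤ d i)
    (hd : ∀ i j, |d i - d j| ≤ |(i : ℝ) - j|)
    (hRR : ∀ i, ∑ j, |(R - R₀) i j| * (1 + |(i : ℝ) - j|) ≤ ε * S) {r r₀ : Fin n → ℝ}
    (hr₀ : l2 (d * r₀) ≤ ρ) (hr : l2 (d * (r - r₀)) ≤ ε * ρ) :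
    l2 (d * (R⁻¹.mulVec r - R₀⁻¹.mulVec r₀)) ≤ ε * weightConst c S ρ := by
  have hdl : ∀ v : Fin n → ℝ, l2 v ≤ l2 (d * v) := fun v => l2_mono fun i => by
    rw [Pi.mul_apply, abs_mul]
    exact le_mul_of_one_le_left (abs_nonneg _) ((hd1 i).trans (le_abs_self _))
  set w := R⁻¹.mulVec r with hw
  set w₀ := R₀⁻¹.mulVec r₀ with hw₀
  have hRw : R.mulVec w = r := h.mulVec_inv hc r
  have hRw₀ : R₀.mulVec w₀ = r₀ := h₀.mulVec_inv hc r₀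
  have h1 : l2 w₀ ≤ ρ / c := by
    refine (h₀.l2_inv_mulVec_le hc r₀).trans ?_
    have := (hdl r₀).trans hr₀
    gcongr
  have h2 : l2 (d * w₀) ≤ (ρ + S * (ρ / c)) / c := by
    have h3 := h₀.l2_weight_mul_le hS hd w₀
    rw [hRw₀] at h3
    rw [le_div_iff₀' hc]
    have := mul_le_mul_of_nonneg_left h1 hS
    linarith
  set W := (ρ + S * (ρ / c)) / c with hW
  set D := R - R₀ with hD
  have hDs : D.IsHermitian := h.symm.sub h₀.symm
  have hrow : ∀ i, ∑ j, |D i j| ≤ ε * S := fun i => sum_abs_le_of_weighted i (hRR i)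
  have hcol : ∀ j, ∑ i, |D i j| ≤ ε * S := fun j => by
    simpa only [abs_symm hDs _ j] using hrow j
  have hεS : 0 ≤ ε * S := mul_nonneg hε hS
  have h3 : l2 (d * D.mulVec w₀) ≤ ε * S * W + ε * S * W := by
    -- The commutator bound is used for the perturbation `D` itself, so both terms carry the small
    -- factor `ε`.
    have e : d * D.mulVec w₀ = D.mulVec (d * w₀) - (D.mulVec (d * w₀) - d * D.mulVec w₀) := by
      abel
    rw [e]
    refine (l2_sub_le _ _).trans (add_le_add ?_ ?_)
    · exact (l2_mulVec_le hεS hrow hcol _).trans (mul_le_mul_of_nonneg_left h2 hεS)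
    · exact (l2_commutator_le hεS hDs hRR hd w₀).trans
        (mul_le_mul_of_nonneg_left ((hdl w₀).trans h2) hεS)
  have e : R.mulVec (w - w₀) = (r - r₀) - D.mulVec w₀ := by
    rw [Matrix.mulVec_sub, hRw, hD, Matrix.sub_mulVec, hRw₀]; abel
  have h4 : l2 (d * R.mulVec (w - w₀)) ≤ ε * (ρ + 2 * S * W) := by
    rw [e, mul_sub]
    refine (l2_sub_le _ _).trans ?_
    linarith
  have h5 : c * l2 (w - w₀) ≤ ε * (ρ + 2 * S * W) :=
    (h.l2_le_mulVec _).trans ((hdl _).trans h4)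
  have h6 := h.l2_weight_mul_le hS hd (w - w₀)
  have h7 : S * l2 (w - w₀) ≤ S / c * (ε * (ρ + 2 * S * W)) := by
    rw [div_mul_eq_mul_div, le_div_iff₀ hc]
    nlinarith [mul_le_mul_of_nonneg_left h5 hS]
  have h8 : c * l2 (d * (w - w₀)) ≤ (1 + S / c) * (ε * (ρ + 2 * S * W)) := by linarith
  rw [← le_div_iff₀' hc] at h8
  refine h8.trans (le_of_eq ?_)
  rw [weightConst, ← hW]; ring

variable {Ω : Type*} [MeasurableSpace Ω] {P : Measure Ω}

/-- The variances of the `y i` are bounded by `S` and the squared weights are summable, so Markov's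
inequality gives a bound free of `n`. -/
lemma measureReal_l2_div_ge_le {c S : ℝ} {n : ℕ} {R₀ : Matrix (Fin n) (Fin n) ℝ}
    (h₀ : WellConditioned c S R₀) {y : Ω → Fin n → ℝ} (hy : HasGaussianLaw y P)
    (h0 : ∀ i, ∫ ω, y ω i ∂P = 0)
    (hcov : ∀ i j, covariance (fun ω => y ω i) (fun ω => y ω j) P = R₀ i j) (hS : 0 ≤ S)
    {T : ℝ} (hT : 0 < T) :
    P.real {ω | T ≤ l2 fun i : Fin n => y ω i / (1 + (i : ℝ))}
      ≤ S * (∑' k : ℕ, (1 + (k : ℝ))⁻¹ ^ 2) / T ^ 2 := by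
  have hyi : ∀ i, HasGaussianLaw (fun ω => y ω i) P := fun i => HasGaussianLaw.eval hy i
  have hint : ∀ i : Fin n, Integrable (fun ω => (y ω i / (1 + (i : ℝ))) ^ 2) P := fun i => by
    simp only [div_pow]
    exact (hyi i).memLp_two.integrable_sq.div_const _
  have h1 := mul_meas_ge_le_integral_of_nonneg (μ := P)
    (f := fun ω => ∑ i : Fin n, (y ω i / (1 + (i : ℝ))) ^ 2)
    (ae_of_all _ fun ω => Finset.sum_nonneg fun i _ => by positivity)
    (integrable_finsetSum _ fun i _ => hint i) (T ^ 2)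
  have h2 : ∫ ω, ∑ i : Fin n, (y ω i / (1 + (i : ℝ))) ^ 2 ∂P
      ≤ S * ∑' k : ℕ, (1 + (k : ℝ))⁻¹ ^ 2 := by
    rw [integral_finsetSum _ fun i _ => hint i]
    have h3 : ∀ i : Fin n, ∫ ω, (y ω i / (1 + (i : ℝ))) ^ 2 ∂P ≤ S * (1 + (i : ℝ))⁻¹ ^ 2 := by
      intro i
      have h4 := hcov i i
      rw [covariance_self (hyi i).aemeasurable,
        variance_of_integral_eq_zero (hyi i).aemeasurable (h0 i)] at h4
      simp only [div_pow]
      rw [integral_div, inv_pow, ← div_eq_mul_inv]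
      have h5 : ∫ ω, y ω i ^ 2 ∂P = R₀ i i := h4
      rw [h5]
      refine div_le_div_of_nonneg_right ((le_abs_self _).trans ?_) (by positivity)
      exact (Finset.single_le_sum (f := fun j => |R₀ i j|) (fun _ _ => abs_nonneg _)
        (Finset.mem_univ i)).trans (h₀.row i)
    refine (Finset.sum_le_sum fun i _ => h3 i).trans ?_
    rw [← Finset.mul_sum]
    refine mul_le_mul_of_nonneg_left ?_ hS
    rw [← Finset.sum_range (fun k : ℕ => (1 + (k : ℝ))⁻¹ ^ 2)]
    exact summable_inv_sq.sum_le_tsum _ fun k _ => by positivity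
  rw [le_div_iff₀ (by positivity), mul_comm]
  refine le_trans (le_of_eq ?_) (h1.trans h2)
  congr 2
  ext ω
  simp only [Set.mem_ofPred_eq]
  rw [← l2_sq, sq_le_sq₀ hT.le (l2_nonneg _)]

end Prediction

/-! ### Decay in the Wasserstein distance turned into decay in the index. -/

lemma exists_envelope {s a : ℝ} (hs : 0 ≤ s) (ha : 0 < a) (b : ℝ) : ∃ C : ℝ, 0 ≤ C ∧
    ∀ t k : ℝ, 0 ≤ t → 0 ≤ k → a * k - b ≤ t → 1 / (1 + t ^ s) ≤ C * (1 + k) ^ (-s) := by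
  set c := 1 + (1 + |b|) / a with hc
  have hc0 : 0 < c := by positivity
  refine ⟨(c * 2) ^ s, by positivity, fun t k ht hk h => ?_⟩
  have h1 : 1 + k ≤ c * (1 + t) := by
    have h2 : k ≤ (t + |b|) / a := by
      rw [le_div_iff₀ ha]; linarith [le_abs_self b]
    have h3 : (1 + |b|) / a * (1 + t) ≥ (t + |b|) / a := by
      rw [div_mul_eq_mul_div]
      gcongr
      nlinarith [abs_nonneg b]
    rw [hc, add_mul]; linarith
  have h2 : (1 + t) ^ s ≤ 2 ^ s * (1 + t ^ s) := by
    have hts : 0 ≤ t ^ s := Real.rpow_nonneg ht s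
    have h2s : (0 : ℝ) ≤ 2 ^ s := Real.rpow_nonneg zero_le_two s
    rcases le_total t 1 with h' | h'
    · have : (1 + t) ^ s ≤ 2 ^ s := Real.rpow_le_rpow (by linarith) (by linarith) hs
      nlinarith
    · have : (1 + t) ^ s ≤ (2 * t) ^ s := Real.rpow_le_rpow (by linarith) (by linarith) hs
      rw [Real.mul_rpow zero_le_two ht] at this
      nlinarith
  have h3 : (1 + k) ^ s ≤ (c * 2) ^ s * (1 + t ^ s) := by
    calc (1 + k) ^ s ≤ (c * (1 + t)) ^ s := Real.rpow_le_rpow (by linarith) h1 hs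
      _ = c ^ s * (1 + t) ^ s := Real.mul_rpow hc0.le (by linarith)
      _ ≤ c ^ s * (2 ^ s * (1 + t ^ s)) := by gcongr
      _ = _ := by rw [Real.mul_rpow hc0.le zero_le_two]; ring
  have h4 : 0 < 1 + t ^ s := by have := Real.rpow_nonneg ht s; linarith
  rw [Real.rpow_neg (by linarith), ← div_eq_mul_inv, div_le_div_iff₀ h4
    (Real.rpow_pos_of_pos (by linarith) s)]
  linarith

/-- This is where `τ > 1` enters: the weight costs one power of decay and the rest must remain
summable. -/
lemma summable_weight {s : ℝ} (hs : 2 < s) :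
    Summable fun k : ℕ => (1 + (k : ℝ)) ^ (-s) * (1 + (k : ℝ)) := by
  have h := (summable_nat_add_iff 1).2 (Real.summable_nat_rpow (p := 1 - s) |>.2 (by linarith))
  refine h.congr fun k => ?_
  push_cast
  rw [add_comm, sub_eq_neg_add, Real.rpow_add (by positivity), Real.rpow_one]

/-- Decay in the distance gives uniformly bounded weighted rows. -/
lemma exists_rowSum_bound {s : ℝ} (hs : 2 < s) (L : ℝ) : ∃ S : ℝ, 0 < S ∧
    ∀ {n : ℕ} (x : Fin n → W2Space), (∀ i : Fin n, (x i).measure.support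
      ⊆ Set.Icc ((i : ℝ) + 1) ((i : ℝ) + 1 + L)) → ∀ (f : ℝ → ℝ) (A : ℝ), 0 ≤ A →
      (∀ t, 0 ≤ t → |f t| ≤ A / (1 + t ^ s)) →
      ∀ i : Fin n, ∑ j : Fin n, |f (W2 (x i) (x j))| * (1 + |(i : ℝ) - j|) ≤ A * S := by
  obtain ⟨C, hC0, hC⟩ := exists_envelope (s := s) (by linarith) one_pos L
  set Z := ∑' k : ℕ, (1 + (k : ℝ)) ^ (-s) * (1 + (k : ℝ)) with hZ
  have hZ0 : 0 ≤ Z := tsum_nonneg fun k => by positivity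
  -- The added `1` only guarantees positivity.
  refine ⟨C * (2 * Z) + 1, by positivity, fun {n} x hx f A hA hf i => ?_⟩
  have hterm : ∀ j : Fin n, |f (W2 (x i) (x j))| * (1 + |(i : ℝ) - j|)
      ≤ A * C * ((1 + ((Nat.dist i j : ℕ) : ℝ)) ^ (-s) * (1 + ((Nat.dist i j : ℕ) : ℝ))) := by
    intro j
    rw [natDist_cast, ← mul_assoc]
    refine mul_le_mul_of_nonneg_right ((hf _ (W2_nonneg _ _)).trans ?_) (by positivity)
    have h1 := le_W2_of_support_subset (hx i) (hx j)
    rw [add_sub_add_right_eq_sub] at h1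
    rw [div_eq_mul_one_div, mul_assoc]
    exact mul_le_mul_of_nonneg_left
      (hC _ _ (W2_nonneg _ _) (abs_nonneg _) (by rwa [one_mul])) hA
  refine (Finset.sum_le_sum fun j _ => hterm j).trans ?_
  rw [← Finset.mul_sum]
  have h2 := sum_fin_dist_le (g := fun k : ℕ => (1 + (k : ℝ)) ^ (-s) * (1 + (k : ℝ)))
    (fun k => by positivity) (summable_weight hs) i
  have h3 := mul_le_mul_of_nonneg_left h2 (mul_nonneg hA hC0)
  refine h3.trans ?_
  rw [← hZ]
  nlinarith

/-- Decay in the distance gives uniformly bounded weighted vectors of covariances. -/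
lemma exists_covVector_bound {s : ℝ} (hs : 2 < s) (L : ℝ) (μ : W2Space) : ∃ ρ : ℝ, 0 ≤ ρ ∧
    ∀ {n : ℕ} (x : Fin n → W2Space), (∀ i : Fin n, (x i).measure.support
      ⊆ Set.Icc ((i : ℝ) + 1) ((i : ℝ) + 1 + L)) → ∀ (f : ℝ → ℝ) (A : ℝ), 0 ≤ A →
      (∀ t, 0 ≤ t → |f t| ≤ A / (1 + t ^ s)) →
      l2 ((fun i : Fin n => 1 + (i : ℝ)) * fun i => f (W2 μ (x i))) ≤ A * ρ := by
  obtain ⟨b, hb⟩ := exists_le_W2_of_support_subset μ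
  obtain ⟨C, hC0, hC⟩ := exists_envelope (s := s) (by linarith) one_half_pos b
  set Z := ∑' k : ℕ, (1 + (k : ℝ)) ^ (-s) * (1 + (k : ℝ)) with hZ
  have hZ0 : 0 ≤ Z := tsum_nonneg fun k => by positivity
  refine ⟨C * Z, by positivity, fun {n} x hx f A hA hf => (l2_le_sum_abs _).trans ?_⟩
  have hterm : ∀ i : Fin n, |((fun i : Fin n => 1 + (i : ℝ)) * fun i => f (W2 μ (x i))) i|
      ≤ A * C * ((1 + (i : ℝ)) ^ (-s) * (1 + (i : ℝ))) := by
    intro i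
    rw [Pi.mul_apply, abs_mul, abs_of_nonneg (by positivity : (0 : ℝ) ≤ 1 + i), mul_comm,
      ← mul_assoc]
    refine mul_le_mul_of_nonneg_right ((hf _ (W2_nonneg _ _)).trans ?_) (by positivity)
    have h1 := hb (x i) ((i : ℝ) + 1) (by positivity) ((hx i).trans Set.Icc_subset_Ici_self)
    rw [div_eq_mul_one_div, mul_assoc]
    exact mul_le_mul_of_nonneg_left
      (hC _ _ (W2_nonneg _ _) (Nat.cast_nonneg _) (by linarith)) hA
  refine (Finset.sum_le_sum fun j _ => hterm j).trans ?_
  rw [← Finset.mul_sum, mul_assoc]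
  refine mul_le_mul_of_nonneg_left (mul_le_mul_of_nonneg_left ?_ hC0) hA
  rw [← Finset.sum_range (fun k : ℕ => (1 + (k : ℝ)) ^ (-s) * (1 + (k : ℝ)))]
  exact (summable_weight hs).sum_le_tsum _ fun k _ => by positivity

/-! ### Mean value inequality along Lipschitz paths. -/

section Paths

variable {E : Type*} [NormedAddCommGroup E] [NormedSpace ℝ E]

/-- The mean value inequality along a Lipschitz path. -/
lemma sub_le_of_lipschitz_path {Θ : Set E} {g : E → ℝ} {M : ℝ} (hg : DifferentiableOn ℝ g Θ)
    (hM : ∀ θ ∈ Θ, ‖fderivWithin ℝ g Θ θ‖ ≤ M) {γ : ℝ → E} {ε : NNReal}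
    (hγ : Set.MapsTo γ (Set.Icc 0 1) Θ) (hL : LipschitzOnWith ε γ (Set.Icc 0 1)) :
    g (γ 1) - g (γ 0) ≤ M * ε := by
  have hcont : ContinuousOn (fun s => g (γ s) - g (γ 0)) (Set.Icc 0 1) :=
    (hg.continuousOn.comp hL.continuousOn hγ).sub continuousOn_const
  -- The path need not be differentiable, so only upper bounds on right slopes of `g ∘ γ` are used;
  -- the little-o error of `g` at `γ s` is absorbed in `η`.
  have key := image_le_of_liminf_slope_right_le_deriv_boundary (a := 0) (b := 1) hcont
    (B := fun s => M * ε * s) (B' := fun _ => M * ε) (by simp) (by fun_prop)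
    (fun x _ => by simpa using ((hasDerivAt_id x).const_mul (M * ε : ℝ)).hasDerivWithinAt) ?_
    (Set.right_mem_Icc.2 zero_le_one)
  · simpa using key
  intro s hs r hr
  have hs' : s ∈ Set.Icc (0 : ℝ) 1 := Set.Ico_subset_Icc_self hs
  obtain ⟨η, hη, hηr⟩ : ∃ η : ℝ, 0 < η ∧ (M + η) * ε < r := by
    have hcont : Continuous fun η : ℝ => (M + η) * (ε : ℝ) := by fun_prop
    have h1 : ∀ᶠ η in 𝓝 (0 : ℝ), (M + η) * (ε : ℝ) < r :=
      hcont.continuousAt.eventually_lt_const (by simpa using hr)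
    obtain ⟨η, h2, h3⟩ := ((h1.filter_mono nhdsWithin_le_nhds).and
      (self_mem_nhdsWithin (s := Set.Ioi (0 : ℝ)))).exists
    exact ⟨η, h3, h2⟩
  have hd := (hg (γ s) (hγ hs')).hasFDerivWithinAt.isLittleO
  have hd' := Asymptotics.isLittleO_iff.1 hd hη
  have hIcc : Set.Icc (0 : ℝ) 1 ∈ 𝓝[>] s :=
    mem_of_superset (Ioc_mem_nhdsGT hs.2) fun z hz => ⟨hs.1.trans hz.1.le, hz.2⟩
  have htend : Tendsto γ (𝓝[>] s) (𝓝[Θ] (γ s)) := by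
    refine tendsto_nhdsWithin_iff.2 ⟨?_, ?_⟩
    · exact (hL.continuousOn s hs').tendsto.mono_left (nhdsWithin_le_of_mem hIcc)
    · filter_upwards [hIcc] with z hz using hγ hz
  refine Eventually.frequently ?_
  filter_upwards [htend.eventually hd', hIcc, self_mem_nhdsWithin] with z hz1 hz2 hz3
  have hzs : 0 < z - s := sub_pos.2 hz3
  rw [slope_def_field, div_lt_iff₀ hzs]
  have h1 : ‖γ z - γ s‖ ≤ ε * (z - s) := by
    have := hL.dist_le_mul z hz2 s hs'
    rwa [dist_eq_norm, Real.dist_eq, abs_of_pos hzs] at this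
  have h2 : ‖fderivWithin ℝ g Θ (γ s) (γ z - γ s)‖ ≤ M * ‖γ z - γ s‖ :=
    (ContinuousLinearMap.le_opNorm _ _).trans
      (mul_le_mul_of_nonneg_right (hM _ (hγ hs')) (norm_nonneg _))
  have hM0 : 0 ≤ M := (norm_nonneg _).trans (hM _ (hγ hs'))
  rw [Real.norm_eq_abs] at hz1 h2
  have h3 := (abs_le.1 hz1).2
  have h4 := (abs_le.1 h2).2
  have h5 := mul_le_mul_of_nonneg_left h1 (by positivity : 0 ≤ M + η)
  nlinarith

end Paths

variable {p : ℕ}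

lemma norm_fderivWithin_le_of_partialDeriv {Θ : Set (EuclideanSpace ℝ (Fin p))}
    (hΘ : UniqueDiffOn ℝ Θ) {g : EuclideanSpace ℝ (Fin p) → ℝ} {M : ℝ} (hM0 : 0 ≤ M)
    {θ : EuclideanSpace ℝ (Fin p)} (hθ : θ ∈ Θ) (hM : ∀ i : Fin p, |partialDeriv Θ ![i] g θ| ≤ M) :
    ‖fderivWithin ℝ g Θ θ‖ ≤ p * M := by
  refine ContinuousLinearMap.opNorm_le_bound _ (by positivity) fun v => ?_
  have hv : v = ∑ i, v i • EuclideanSpace.single i (1 : ℝ) := by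
    conv_lhs => rw [← (EuclideanSpace.basisFun (Fin p) ℝ).sum_repr v]
    simp
  have hi : ∀ i, |fderivWithin ℝ g Θ θ (EuclideanSpace.single i 1)| ≤ M := fun i => by
    have := hM i
    rw [partialDeriv, iteratedFDerivWithin_one_apply (hΘ θ hθ)] at this
    simpa using this
  conv_lhs => rw [hv]
  rw [map_sum, Real.norm_eq_abs]
  refine (Finset.abs_sum_le_sum_abs _ _).trans ?_
  refine (Finset.sum_le_sum (g := fun _ => M * ‖v‖) fun i _ => ?_).trans (le_of_eq ?_)
  · rw [map_smul, smul_eq_mul, abs_mul, mul_comm]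
    exact mul_le_mul (hi i) (PiLp.norm_apply_le v i) (abs_nonneg _) hM0
  · simp; ring

/-- The mean value inequality along a short path, in terms of the partial derivatives. -/
lemma abs_sub_le_of_lipschitz_path {Θ : Set (EuclideanSpace ℝ (Fin p))}
    (hΘ : UniqueDiffOn ℝ Θ) {g : EuclideanSpace ℝ (Fin p) → ℝ} {M : ℝ} (hM0 : 0 ≤ M)
    (hg : ContDiffOn ℝ 1 g Θ) (hM : ∀ θ ∈ Θ, ∀ i : Fin p, |partialDeriv Θ ![i] g θ| ≤ M)
    {γ : ℝ → EuclideanSpace ℝ (Fin p)} {ε : NNReal}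
    (hγ : Set.MapsTo γ (Set.Icc 0 1) Θ) (hL : LipschitzOnWith ε γ (Set.Icc 0 1)) :
    |g (γ 1) - g (γ 0)| ≤ p * M * ε := by
  have hd : DifferentiableOn ℝ g Θ := hg.differentiableOn (by norm_num)
  have hb : ∀ θ ∈ Θ, ‖fderivWithin ℝ g Θ θ‖ ≤ p * M := fun θ hθ =>
    norm_fderivWithin_le_of_partialDeriv hΘ hM0 hθ (hM θ hθ)
  have h1 := sub_le_of_lipschitz_path hd hb hγ hL
  -- The one-sided inequality for `-g` gives the other half of the absolute value.
  have h2 := sub_le_of_lipschitz_path (g := fun θ => -g θ) hd.neg (M := p * M) (fun θ hθ => by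
    have := hb θ hθ
    rwa [fderivWithin_fun_neg (hΘ θ hθ), norm_neg]) hγ hL
  rw [abs_le]
  constructor <;> linarith

lemma dotProduct_predictor {F : EuclideanSpace ℝ (Fin p) → ℝ → ℝ} {n : ℕ} {x : Fin n → W2Space}
    {c S : ℝ} {θ : EuclideanSpace ℝ (Fin p)} (h : WellConditioned c S (covMatrix F x θ))
    (y : Fin n → ℝ) (μ : W2Space) :
    predictor F x y μ θ = (covMatrix F x θ)⁻¹.mulVec (covVector F x μ θ) ⬝ᵥ y := by
  have ht : ((covMatrix F x θ)⁻¹)ᵀ = (covMatrix F x θ)⁻¹ := by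
    have := h.inv_symm.eq
    rwa [Matrix.conjTranspose_eq_transpose_of_trivial] at this
  rw [predictor, Matrix.dotProduct_mulVec, ← Matrix.mulVec_transpose, ht]

lemma abs_dotProduct_le_weighted {n : ℕ} (w y : Fin n → ℝ) :
    |w ⬝ᵥ y| ≤ l2 ((fun i : Fin n => 1 + (i : ℝ)) * w)
      * l2 fun i : Fin n => y i / (1 + (i : ℝ)) := by
  refine le_trans (le_of_eq ?_) (abs_dotProduct_le _ _)
  congr 1
  refine Finset.sum_congr rfl fun i _ => ?_
  have : (1 + (i : ℝ)) ≠ 0 := by positivity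
  rw [Pi.mul_apply]
  field_simp

/-- The likelihood criterion, without its normalization. -/
lemma mlCriterion_le_iff {F : EuclideanSpace ℝ (Fin p) → ℝ → ℝ} {n : ℕ} (hn : 0 < n)
    {x : Fin n → W2Space} {y : Fin n → ℝ} {θ θ' : EuclideanSpace ℝ (Fin p)} :
    mlCriterion F x y θ ≤ mlCriterion F x y θ' ↔
      Real.log (covMatrix F x θ).det + y ⬝ᵥ (covMatrix F x θ)⁻¹.mulVec y
        ≤ Real.log (covMatrix F x θ').det + y ⬝ᵥ (covMatrix F x θ')⁻¹.mulVec y := by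
  have : (0 : ℝ) < 1 / n := by positivity
  rw [mlCriterion, mlCriterion, ← mul_add, ← mul_add, mul_le_mul_iff_right₀ this]

end Kriging

end

/-! ### Conclusion: consistency combined with stability of the predictor. -/

theorem mainTheorem6
    {Ω : Type*} [MeasurableSpace Ω] (P : Measure Ω) [IsProbabilityMeasure P]
    -- the parameter set, the true parameter, and the covariance model
    (p : ℕ) (Θ : Set (EuclideanSpace ℝ (Fin p))) (θ₀ : EuclideanSpace ℝ (Fin p))
    (F : EuclideanSpace ℝ (Fin p) → ℝ → ℝ)
    (hΘ : UniqueDiffOn ℝ Θ) (hΘ₀ : Kriging.ShortPathsAt Θ θ₀)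
    (hK : ∀ θ ∈ Θ, Kriging.IsCovarianceFunction (Kriging.cov F θ))
    -- Condition 1: the triangular array of observation points
    (x : ∀ n : ℕ, Fin n → Kriging.W2Space) (L : ℝ)
    (h1 : ∀ (n : ℕ) (i : Fin n),
      (x n i).measure.support ⊆ Set.Icc ((i : ℝ) + 1) ((i : ℝ) + 1 + L))
    -- Condition 2
    (A τ : ℝ) (hτ : 1 < τ)
    (h2 : ∀ θ ∈ Θ, ∀ t : ℝ, 0 ≤ t → |F θ t| ≤ A / (1 + t ^ (1 + τ)))
    -- Condition 3: the centered Gaussian process with covariance function `K_θ₀`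
    (Y : Kriging.W2Space → Ω → ℝ) (h3 : θ₀ ∈ Θ) (hY : IsGaussianProcess Y P)
    (hYmean : ∀ μ, ∫ ω, Y μ ω ∂P = 0)
    (hYcov : ∀ μ ν, covariance (Y μ) (Y ν) P = Kriging.cov F θ₀ μ ν)
    -- Condition 4: all eigenvalues of all `R_θ` are at least `c`
    (c : ℝ) (hc : 0 < c)
    (h4 : ∀ n : ℕ, ∀ θ ∈ Θ, ∀ l ∈ spectrum ℝ (Kriging.covMatrix F (x n) θ), c ≤ l)
    -- Condition 5
    (h5 : ∀ α : ℝ, 0 < α →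
      (0 : EReal) < liminf (fun n : ℕ => ⨅ θ ∈ {θ | θ ∈ Θ ∧ α ≤ ‖θ - θ₀‖},
        ((1 / (n : ℝ) * ∑ i : Fin n, ∑ j : Fin n,
          (Kriging.cov F θ (x n i) (x n j) - Kriging.cov F θ₀ (x n i) (x n j)) ^ 2 : ℝ) : EReal))
        atTop)
    -- Condition 6
    (h6 : ∀ t : ℝ, 0 ≤ t → ContDiffOn ℝ 1 (fun θ => F θ t) Θ)
    (h6' : ∀ θ ∈ Θ, ∀ t : ℝ, 0 ≤ t → ∀ i : Fin p,
      |Kriging.partialDeriv Θ ![i] (fun ϑ => F ϑ t) θ| ≤ A / (1 + t ^ (1 + τ)))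
    -- Condition 7
    (h7 : ∀ t : ℝ, 0 ≤ t → ContDiffOn ℝ 3 (fun θ => F θ t) Θ)
    (h7' : ∀ q : ℕ, q = 2 ∨ q = 3 → ∀ i : Fin q → Fin p, ∀ θ ∈ Θ, ∀ t : ℝ, 0 ≤ t →
      |Kriging.partialDeriv Θ i (fun ϑ => F ϑ t) θ| ≤ A / (1 + t ^ (1 + τ)))
    -- Condition 8
    (h8 : ∀ l : Fin p → ℝ, l ≠ 0 →
      (0 : EReal) < liminf (fun n : ℕ =>
        ((1 / (n : ℝ) * ∑ i : Fin n, ∑ j : Fin n,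
          (∑ k : Fin p, l k *
            Kriging.partialDeriv Θ ![k] (fun ϑ => Kriging.cov F ϑ (x n i) (x n j)) θ₀) ^ 2 : ℝ)
          : EReal)) atTop)
    -- the maximum likelihood estimator from the observations `Y (x n i)`
    (θML : ℕ → Ω → EuclideanSpace ℝ (Fin p))
    (hML : ∀ n : ℕ, ∀ᵐ ω ∂P, θML n ω ∈ Θ ∧
      IsMinOn (Kriging.mlCriterion F (x n) (fun i => Y (x n i) ω)) Θ (θML n ω)) :
    ∀ μ : Kriging.W2Space,
      TendstoInMeasure P
        (fun (n : ℕ) (ω : Ω) =>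
          |Kriging.predictor F (x n) (fun i => Y (x n i) ω) μ (θML n ω)
            - Kriging.predictor F (x n) (fun i => Y (x n i) ω) μ θ₀|)
        atTop (fun _ => 0) := by
  classical
  have hs : 2 < 1 + τ := by linarith
  have hA : 0 ≤ A := by
    have := h2 θ₀ h3 0 le_rfl
    rw [Real.zero_rpow (by linarith), add_zero, div_one] at this
    exact (abs_nonneg _).trans this
  have hFA : ∀ θ ∈ Θ, ∀ t, 0 ≤ t → |F θ t| ≤ A := fun θ hθ t ht =>
    (h2 θ hθ t ht).trans (div_le_self hA (by linarith [Real.rpow_nonneg ht (1 + τ)]))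
  obtain ⟨S₁, hS₁, hrow⟩ := Kriging.exists_rowSum_bound hs L
  -- Using `A + 1` instead of `A` keeps `S` positive even when `A = 0`.
  set S := (A + 1) * S₁ with hS
  have hS0 : 0 < S := by positivity
  have hwc : ∀ n, ∀ θ ∈ Θ, Kriging.WellConditioned c S (Kriging.covMatrix F (x n) θ) := by
    intro n θ hθ
    have hsym : (Kriging.covMatrix F (x n) θ).IsHermitian := (hK θ hθ n (x n)).isHermitian
    refine ⟨hsym, Kriging.coercive_of_spectrum hsym (h4 n θ hθ), fun i => ?_⟩
    refine (hrow (x n) (h1 n) (F θ) A hA (h2 θ hθ) i).trans ?_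
    rw [hS]; nlinarith
  let y : ∀ n, Ω → Fin n → ℝ := fun n ω i => Y (x n i) ω
  have hy : ∀ n, HasGaussianLaw (y n) P := fun n => Kriging.hasGaussianLaw_pi hY (x n)
  have hy0 : ∀ n i, ∫ ω, y n ω i ∂P = 0 := fun n i => hYmean _
  have hycov : ∀ n i j, covariance (fun ω => y n ω i) (fun ω => y n ω j) P
      = Kriging.covMatrix F (x n) θ₀ i j := fun n i j => hYcov _ _
  have hnet : ∀ ε : ℝ, 0 < ε → ∃ N n₀ : ℕ, ∀ n, n₀ ≤ n → ∃ G : Finset Θ, G.card ≤ N ∧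
      ∀ a : Θ, ∃ b ∈ G, ∑ i, ∑ j, |Kriging.covMatrix F (x n) a i j
        - Kriging.covMatrix F (x n) b i j| ≤ ε * n := by
    intro ε hε
    obtain ⟨N, n₀, h⟩ := Kriging.exists_finite_net A S hε
    refine ⟨N, n₀, fun n hn => h n hn (fun i j => Kriging.W2 (x n i) (x n j))
      (fun i j => Kriging.W2_nonneg _ _) (fun a : Θ => F a) (fun a => ?_)
      (fun a => hFA a a.2) fun a => (hwc n a a.2).rowSum⟩
    exact Kriging.antitoneOn_of_isCovarianceFunction (hFA a a.2) (hK a a.2)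
  intro μ
  obtain ⟨ρ, hρ, hvec⟩ := Kriging.exists_covVector_bound hs L μ
  rw [tendstoInMeasure_iff_measureReal_norm]
  intro η hη
  rw [Metric.tendsto_atTop']
  intro r hr
  set Z := ∑' k : ℕ, (1 + (k : ℝ))⁻¹ ^ 2 with hZ
  have hZ0 : 0 ≤ Z := tsum_nonneg fun k => by positivity
  set Cw := Kriging.weightConst c S (A * ρ) with hCw
  have hCw0 : 0 ≤ Cw := by rw [hCw, Kriging.weightConst]; positivity
  obtain ⟨T, hT, hTr⟩ : ∃ T : ℝ, 0 < T ∧ S * Z / T ^ 2 < r / 2 := by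
    have h : Tendsto (fun T : ℝ => S * Z / T ^ 2) atTop (𝓝 0) :=
      tendsto_const_nhds.div_atTop (tendsto_pow_atTop two_ne_zero)
    obtain ⟨T, h1, h2⟩ := ((h.eventually_lt_const (half_pos hr)).and
      (eventually_gt_atTop 0)).exists
    exact ⟨T, h2, h1⟩
  obtain ⟨ε, hε, hεη⟩ : ∃ ε : NNReal, 0 < ε ∧ (p : ℝ) * ε * Cw * T < η := by
    have hcont : Continuous fun ε : ℝ => (p : ℝ) * ε * Cw * T := by fun_prop
    have h1 : ∀ᶠ ε in 𝓝 (0 : ℝ), (p : ℝ) * ε * Cw * T < η :=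
      hcont.continuousAt.eventually_lt_const (by simpa using hη)
    obtain ⟨ε, h2, h3⟩ := ((h1.filter_mono nhdsWithin_le_nhds).and
      (self_mem_nhdsWithin (s := Set.Ioi (0 : ℝ)))).exists
    have h3' : 0 < ε := h3
    exact ⟨ε.toNNReal, Real.toNNReal_pos.2 h3', by rwa [Real.coe_toNNReal _ h3'.le]⟩
  obtain ⟨α, hα, hpath⟩ := hΘ₀ ε hε
  -- The gradient bound is applied for each fixed `t`, so the difference keeps the decay in `t` and
  -- gains the factor `p * ε`; the row and vector bounds then apply to it as well.
  have hclose : ∀ θ ∈ Θ, ‖θ - θ₀‖ < α → ∀ t, 0 ≤ t →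
      |F θ t - F θ₀ t| ≤ ((p : ℝ) * ε * A) / (1 + t ^ (1 + τ)) := by
    intro θ hθ hθα t ht
    obtain ⟨γ, hγ0, hγ1, hγΘ, hγL⟩ := hpath θ hθ hθα
    have hden : 0 < 1 + t ^ (1 + τ) := by linarith [Real.rpow_nonneg ht (1 + τ)]
    have h := Kriging.abs_sub_le_of_lipschitz_path hΘ (M := A / (1 + t ^ (1 + τ)))
      (div_nonneg hA hden.le) (h6 t ht) (fun θ hθ i => h6' θ hθ t ht i) hγΘ hγL
    rw [hγ0, hγ1] at h
    refine h.trans (le_of_eq ?_)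
    ring
  have hpred : ∀ n, ∀ θ ∈ Θ, ‖θ - θ₀‖ < α → ∀ v : Fin n → ℝ,
      |Kriging.predictor F (x n) v μ θ - Kriging.predictor F (x n) v μ θ₀|
        ≤ (p : ℝ) * ε * Cw * Kriging.l2 fun i : Fin n => v i / (1 + (i : ℝ)) := by
    intro n θ hθ hθα v
    rw [Kriging.dotProduct_predictor (hwc n θ hθ), Kriging.dotProduct_predictor (hwc n θ₀ h3),
      ← sub_dotProduct]
    refine (Kriging.abs_dotProduct_le_weighted _ _).trans
      (mul_le_mul_of_nonneg_right ?_ (Kriging.l2_nonneg _))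
    refine Kriging.l2_weight_inv_mulVec_sub_le hc hS0.le (by positivity) (hwc n θ hθ)
      (hwc n θ₀ h3) (fun i => by simp) (fun i j => by simp) (fun i => ?_)
      (hvec (x n) (h1 n) (F θ₀) A hA (h2 θ₀ h3)) ?_
    · refine (hrow (x n) (h1 n) (fun t => F θ t - F θ₀ t) (p * ε * A) (by positivity)
        (hclose θ hθ hθα) i).trans ?_
      rw [hS, mul_assoc]
      refine mul_le_mul_of_nonneg_left ?_ (by positivity)
      nlinarith
    · have := hvec (x n) (h1 n) (fun t => F θ t - F θ₀ t) (p * ε * A) (by positivity)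
        (hclose θ hθ hθα)
      rw [mul_assoc _ A ρ] at this
      exact this
  obtain ⟨κ, hκ0, hκ⟩ := EReal.lt_iff_exists_real_btwn.1 (h5 α hα)
  have hκ0' : 0 < κ := by exact_mod_cast hκ0
  have hev := eventually_lt_of_lt_liminf hκ
  have hcons := Kriging.tendsto_measureReal_exists_criterion_le (P := P) hc hS0 hy hy0
    (ι := Θ) (R := fun n a => Kriging.covMatrix F (x n) a) ⟨θ₀, h3⟩ hycov
    (fun n a => hwc n a a.2) hnet hκ0'
  obtain ⟨n₀, hn₀⟩ := eventually_atTop.1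
    ((hev.and (hcons.eventually_lt_const (half_pos hr))).and (eventually_gt_atTop 0))
  refine ⟨n₀, fun n hn => ?_⟩
  obtain ⟨⟨hn1, hn2⟩, hn3⟩ := hn₀ n hn.le
  have hn' : (0 : ℝ) < n := by exact_mod_cast hn3
  rw [Real.dist_eq, sub_zero, abs_of_nonneg measureReal_nonneg]
  refine lt_of_le_of_lt (b := _ + _) ?_ ((add_lt_add_of_lt_of_le hn2
    ((Kriging.measureReal_l2_div_ge_le (P := P) (hwc n θ₀ h3) (hy n) (hy0 n) (hycov n)
      hS0.le hT).trans hTr.le)).trans_eq (add_halves r))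
  refine le_trans ?_ (measureReal_union_le _ _)
  -- The bad event lies almost surely in the union of two events: a parameter at distance at least
  -- `α` beating `θ₀`, or a large weighted norm of the observations. Monotonicity of the outer
  -- measure suffices, so no measurability of `θML` is needed.
  refine ENNReal.toReal_mono (measure_ne_top _ _) (measure_mono_ae ?_)
  filter_upwards [hML n] with ω hω hbad
  change η ≤ ‖|Kriging.predictor F (x n) (y n ω) μ (θML n ω)
    - Kriging.predictor F (x n) (y n ω) μ θ₀| - 0‖ at hbad
  rw [sub_zero, Real.norm_eq_abs, abs_abs] at hbad
  by_cases hfar : α ≤ ‖θML n ω - θ₀‖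
  · left
    refine ⟨⟨θML n ω, hω.1⟩, ?_, (Kriging.mlCriterion_le_iff hn3).1 (hω.2 h3)⟩
    have h := hn1.trans_le (iInf₂_le (θML n ω) ⟨hω.1, hfar⟩)
    rw [EReal.coe_lt_coe_iff, one_div, lt_inv_mul_iff₀ hn', mul_comm] at h
    exact h.le
  · right
    have h := hpred n (θML n ω) hω.1 (not_le.1 hfar) (y n ω)
    by_contra hcon
    have hcon' : (Kriging.l2 fun i : Fin n => y n ω i / (1 + (i : ℝ))) ≤ T := (not_le.1 hcon).le
    have := mul_le_mul_of_nonneg_left hcon' (by positivity : 0 ≤ (p : ℝ) * ε * Cw)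
    linarith
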